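/- Let $n\ge 1$ and let $B=(b_{ij})$ be a skew-symmetrizable integer $n\times n$ matrix. Write $[b]_+=\max(b,0)$. Let $\mathbb{P}=\mathrm{Trop}(y_1,\dots,y_n)$ be the tropical semifield, i.e. the free multiplicative abelian group on $y_1,\dots,y_n$ with $\prod_i y_i^{a_i}\oplus\prod_i y_i^{b_i}=\prod_i y_i^{\min(a_i,b_i)}$, and let $\mathcal F=\mathbb{Q}\mathbb{P}(x_1,\dots,x_n)$, where $\mathbb{Q}\mathbb{P}$ is the field of fractions of the group ring $\mathbb{Z}\mathbb{P}$. Mutation of a labeled seed $(\mathbf x,\mathbf y,B)$ in direction $k$ gives $(\mathbf x',\mathbf y',B')$ with $x_i'=x_i$ for $i\ne k$, $$x_k'=x_k^{-1}\Big(\tfrac{y_k}{1\oplus y_k}\prod_j x_j^{[b_{jk}]_+}+\tfrac{1}{1\oplus y_k}\prod_j x_j^{[-b_{jk}]_+}\Big),$$ $y_k'=y_k^{-1}$, $y_i'=y_iy_k^{[b_{ki}]_+}(1\oplus y_k)^{-b_{ki}}$ for $i\neq k$, and $b_{ij}'=-b_{ij}$ if $i=k$ or $j=k$, $b'_{ij}=b_{ij}+[b_{ik}]_+b_{kj}+b_{ik}[-b_{kj}]_+$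 otherwise. The cluster pattern with principal coefficients and initial exchange matrix $B$ assigns to each vertex $t$ of the $n$-regular tree $\mathbb{T}_n$ the seed $(\mathbf x_t,\mathbf y_t,B_t)$ obtained from the initial seed $((x_1,\dots,x_n),(y_1,\dots,y_n),B)$ at $t_0$ by mutating along the labels of the path from $t_0$ to $t$. Assume that it is of type $A_n$: for some vertex $t$ the Cartan counterpart of $B_t$ (diagonal entries $2$, off-diagonal entries $-|b_{ij;t}|$) is, up to a simultaneous permutation of rows and columns, the Cartan matrix of type $A_n$. Then for every vertex $t$ and every $i\in\{1,\dots,n\}$ the $F$-polynomial $$F_{i;t}(y_1,\dots,y_n)=x_{i;t}\big|_{x_1=\cdots=x_n=1}$$ is a well-defined element of $\mathbb{Z}[y_1,\dots,y_n]$, its degree in each variable $y_j$ is at most $1$, and it is log-concave: it is nonzero, it has non-negative coefficients, and its coefficients $a_{i_1,\dots,i_n}$ satisfy $$a_{i_1,\dots,i_j,\dots,i_n}^2\ \ge\ a_{i_1,\dots,i_j-1,\dots,i_n}\,a_{i_1,\dots,i_j+1,\dots,i_n}$$ for all $j$ and all exponents, where coefficients at negative exponents are $0$. -/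

import Mathlib

noncomputable section

namespace Cluster

/-- The multiplicative group of the tropical semifield `Trop(y_1, …, y_n)`: Laurent monomials in
`y_1, …, y_n`, each given by its vector of exponents. -/
abbrev Trop (n : ℕ) : Type := Multiplicative (Fin n → ℤ)

/-- The generator `y_i` of `Trop(y_1, …, y_n)`. -/
def Trop.gen {n : ℕ} (i : Fin n) : Trop n := Multiplicative.ofAdd (Pi.single i 1)

/-- The addition `⊕` of the tropical semifield: componentwise minimum of exponents. -/
def Trop.oplus {n : ℕ} (a b : Trop n) : Trop n :=
  Multiplicative.ofAdd fun i => min (Multiplicative.toAdd a i) (Multiplicative.toAdd b i)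

/-- `ℚℙ`, the field of fractions of the group ring `ℤℙ = ℤ[y_1^{±1}, …, y_n^{±1}]` of
`ℙ = Trop(y_1, …, y_n)`; it is the field of fractions of `ℤ[y_1, …, y_n]`. -/
abbrev CoeffField (n : ℕ) : Type := FractionRing (MvPolynomial (Fin n) ℤ)

/-- The ambient field: rational functions in `x_1, …, x_n` over `ℚℙ`. -/
abbrev AmbientField (n : ℕ) : Type := FractionRing (MvPolynomial (Fin n) (CoeffField n))

/-- A Laurent monomial in `y_1, …, y_n` as an element of `ℚℙ`. -/
def Trop.toCoeff {n : ℕ} (a : Trop n) : CoeffField n :=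
  ∏ i, algebraMap (MvPolynomial (Fin n) ℤ) (CoeffField n) (MvPolynomial.X i) ^
    Multiplicative.toAdd a i

/-- A Laurent monomial in `y_1, …, y_n` as an element of the ambient field. -/
def Trop.toAmbient {n : ℕ} (a : Trop n) : AmbientField n :=
  algebraMap (MvPolynomial (Fin n) (CoeffField n)) (AmbientField n) (MvPolynomial.C a.toCoeff)

/-- The data `(x, y, B)` of a labeled seed over `Trop(y_1, …, y_n)`. -/
structure Seed (n : ℕ) where
  x : Fin n → AmbientField n
  y : Fin n → Trop n
  B : Matrix (Fin n) (Fin n) ℤ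

/-- Mutation of the matrix `B` in direction `k`, with `[b]_+ = max b 0`. -/
def mutateMatrix {n : ℕ} (k : Fin n) (B : Matrix (Fin n) (Fin n) ℤ) :
    Matrix (Fin n) (Fin n) ℤ :=
  Matrix.of fun i j =>
    if i = k ∨ j = k then - B i j
    else B i j + max (B i k) 0 * B k j + B i k * max (- B k j) 0

/-- Seed mutation in direction `k`. -/
def Seed.mutate {n : ℕ} (k : Fin n) (s : Seed n) : Seed n where
  x := fun i =>
    if i = k then
      (s.x k)⁻¹ *
        (Trop.toAmbient (s.y k / Trop.oplus 1 (s.y k)) * ∏ j, s.x j ^ max (s.B j k) 0 +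
          Trop.toAmbient (1 / Trop.oplus 1 (s.y k)) * ∏ j, s.x j ^ max (- s.B j k) 0)
    else s.x i
  y := fun i =>
    if i = k then (s.y k)⁻¹
    else s.y i * s.y k ^ max (s.B k i) 0 * (Trop.oplus 1 (s.y k)) ^ (- s.B k i)
  B := mutateMatrix k s.B

/-- The initial seed with principal coefficients: `x_i` are the indeterminates of the ambient
field and `y_i` are the generators of the tropical semifield. -/
def initialSeed {n : ℕ} (B : Matrix (Fin n) (Fin n) ℤ) : Seed n where
  x := fun i => algebraMap (MvPolynomial (Fin n) (CoeffField n)) (AmbientField n)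
    (MvPolynomial.X i)
  y := Trop.gen
  B := B

/-- The seed `(x_t, y_t, B_t)` at the vertex `t` of the `n`-regular tree that is reached from `t_0`
by following the edges labeled by the successive entries of `w`. Every vertex is reached in this
way. -/
def seedAt {n : ℕ} (B : Matrix (Fin n) (Fin n) ℤ) (w : List (Fin n)) : Seed n :=
  w.foldl (fun s k => s.mutate k) (initialSeed B)

/-- `DB` is skew-symmetric for some diagonal matrix `D` with positive integer diagonal entries. -/
def IsSkewSymmetrizable {n : ℕ} (B : Matrix (Fin n) (Fin n) ℤ) : Prop :=
  ∃ d : Fin n → ℤ, (∀ i, 0 < d i) ∧ ∀ i j, d i * B i j = - (d j * B j i)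

/-- The Cartan counterpart `A(B)`. -/
def cartanCounterpart {n : ℕ} (B : Matrix (Fin n) (Fin n) ℤ) : Matrix (Fin n) (Fin n) ℤ :=
  Matrix.of fun i j => if i = j then 2 else - |B i j|

/-- The cluster algebra with initial exchange matrix `B` is of type `A_n`: some exchange matrix
of its cluster pattern has as Cartan counterpart the Cartan matrix of type `A_n`, up to a
relabeling of the indices. -/
def IsTypeA {n : ℕ} (B : Matrix (Fin n) (Fin n) ℤ) : Prop :=
  ∃ (w : List (Fin n)) (σ : Equiv.Perm (Fin n)),
    (cartanCounterpart (seedAt B w).B).submatrix σ σ = CartanMatrix.A n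

/-- The rational function `z` in `x_1, …, x_n` over `ℚℙ` is regular at `x_1 = ⋯ = x_n = 1`
and takes the value `v ∈ ℚℙ` there. -/
def HasValueAtOne {n : ℕ} (z : AmbientField n) (v : CoeffField n) : Prop :=
  ∃ N D : MvPolynomial (Fin n) (CoeffField n),
    MvPolynomial.eval (fun _ => 1) D ≠ 0 ∧
    z = algebraMap _ (AmbientField n) N / algebraMap _ (AmbientField n) D ∧
    v = MvPolynomial.eval (fun _ => 1) N / MvPolynomial.eval (fun _ => 1) D

/-- `F ∈ ℤ[y_1, …, y_n]` is the `F`-polynomial `F_{i;t}^{B;t_0}`, that is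
`x_{i;t}|_{x_1 = ⋯ = x_n = 1}` for the cluster algebra with principal coefficients at `t_0` and
initial exchange matrix `B`, where `t` is the vertex reached from `t_0` along `w`. -/
def IsFPolynomial {n : ℕ} (B : Matrix (Fin n) (Fin n) ℤ) (w : List (Fin n)) (i : Fin n)
    (F : MvPolynomial (Fin n) ℤ) : Prop :=
  HasValueAtOne ((seedAt B w).x i) (algebraMap (MvPolynomial (Fin n) ℤ) (CoeffField n) F)

/-- The coefficient of `f` at an integer vector of exponents (zero if an exponent is negative). -/
def intCoeff {m : ℕ} (f : MvPolynomial (Fin m) ℝ) (a : Fin m → ℤ) : ℝ :=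
  if ∀ j, 0 ≤ a j then f.coeff (Finsupp.equivFunOnFinite.symm fun j => (a j).toNat) else 0

/-- Log-concavity of a polynomial: it is nonzero, has non-negative real coefficients, and
`a_{…,i_j,…}^2 ≥ a_{…,i_j-1,…} a_{…,i_j+1,…}` in each variable separately. -/
def IsLogConcave {m : ℕ} (f : MvPolynomial (Fin m) ℝ) : Prop :=
  f ≠ 0 ∧ (∀ a, 0 ≤ f.coeff a) ∧
    ∀ (j : Fin m) (a : Fin m → ℤ),
      intCoeff f (a - Pi.single j 1) * intCoeff f (a + Pi.single j 1) ≤ intCoeff f a ^ 2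

end Cluster

end

/-
Cluster patterns of type `A_n` are modelled by triangulations of the `(n + 3)`-gon, mutations being
flips of diagonals. Weight the Ptolemy relations by the elementary laminations of an initial
triangulation and set the lengths of its edges to `1`: the resulting lengths of the other diagonals
satisfy the exchange relations specialized at `x_1 = ⋯ = x_n = 1`, hence are the `F`-polynomials.
Induction on the set of initial diagonals crossed by a diagonal shows that its length is a
polynomial with non-negative coefficients and of degree at most `1` in each variable. In such a
polynomial one of the coefficients at `i_j - 1` and `i_j + 1` always vanishes, so it is log-concave.
-/

noncomputable section

namespace Cluster

attribute [local instance] LinearOrder.toCircularOrder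

variable {n : ℕ}

/-- The chord joining the vertices `a` and `b` of a convex polygon with vertices `0, 1, 2, …`,
encoded by its sorted pair of endpoints. -/
def chord (a b : ℕ) : ℕ × ℕ := (min a b, max a b)

theorem chord_comm (a b : ℕ) : chord a b = chord b a :=
  Prod.ext (min_comm a b) (max_comm a b)

theorem chord_of_lt {x : ℕ × ℕ} (hx : x.1 < x.2) : chord x.1 x.2 = x :=
  Prod.ext (min_eq_left hx.le) (max_eq_right hx.le)

theorem chord_eq_chord_iff {a b c d : ℕ} :
    chord a b = chord c d ↔ a = c ∧ b = d ∨ a = d ∧ b = c := by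
  simp only [chord, Prod.mk.injEq]
  omega

/-- Two chords cross in their interiors. -/
def Crosses (x y : ℕ × ℕ) : Prop :=
  (x.1 < y.1 ∧ y.1 < x.2 ∧ x.2 < y.2) ∨ (y.1 < x.1 ∧ x.1 < y.2 ∧ y.2 < x.2)

theorem crosses_comm {x y : ℕ × ℕ} : Crosses x y ↔ Crosses y x := Or.comm

/-- The vertices `a`, `b`, `c`, `d` are distinct and occur in this cyclic order around the
polygon. -/
def CyclicallyOrdered (a b c d : ℕ) : Prop := sbtw a b c ∧ sbtw a c d

theorem CyclicallyOrdered.rotate {a b c d : ℕ} (h : CyclicallyOrdered a b c d) :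
    CyclicallyOrdered b c d a := by
  simp only [CyclicallyOrdered, sbtw_iff] at *
  omega

theorem CyclicallyOrdered.crosses {a b c d : ℕ} (h : CyclicallyOrdered a b c d) :
    Crosses (chord a c) (chord b d) := by
  simp only [CyclicallyOrdered, sbtw_iff, Crosses, chord] at *
  omega

theorem exists_eq_chord_of_crosses {a b c : ℕ} {x : ℕ × ℕ} (habc : sbtw a b c)
    (hbc : Crosses x (chord b c)) (hab : ¬ Crosses x (chord a b))
    (hac : ¬ Crosses x (chord a c)) : ∃ s, sbtw b s c ∧ x = chord a s := by
  obtain ⟨p, q⟩ := x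
  by_cases hp : p = a
  · refine ⟨q, ?_⟩
    simp only [sbtw_iff, Crosses, chord, Prod.mk.injEq] at *
    omega
  · refine ⟨p, ?_⟩
    simp only [sbtw_iff, Crosses, chord, Prod.mk.injEq] at *
    omega

/-- Edge labels of a triangulated `(n + 3)`-gon: the `n` diagonals and the `n + 3` sides. -/
abbrev EdgeLabel (n : ℕ) : Type := Fin n ⊕ Fin (n + 3)

/-- The vertex that follows `v` in the cyclic order of the `(n + 3)`-gon. -/
def nextVertex (n v : ℕ) : ℕ := if v = n + 2 then 0 else v + 1

theorem nextVertex_le {v : ℕ} (hv : v ≤ n + 2) : nextVertex n v ≤ n + 2 := by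
  unfold nextVertex
  split_ifs <;> omega

theorem sbtw_nextVertex {a v c : ℕ} (hv : v ≤ n + 2) (h : sbtw a v c) :
    sbtw a (nextVertex n a) c := by
  unfold nextVertex
  simp only [sbtw_iff] at *
  split_ifs <;> omega

theorem sbtw_nextVertex_of_ne {a c : ℕ} (hc : c ≤ n + 2) (hac : a ≠ c)
    (h : nextVertex n a ≠ c) : sbtw a (nextVertex n a) c := by
  unfold nextVertex at *
  simp only [sbtw_iff]
  split_ifs at * <;> omega

/-- A labeled triangulation of the polygon with vertices `0, …, n + 2`: a maximal family of
pairwise noncrossing chords, the last `n + 3` of which are the sides. -/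
structure IsTriangulation (e : EdgeLabel n → ℕ × ℕ) : Prop where
  lt : ∀ j, (e j).1 < (e j).2
  le : ∀ j, (e j).2 ≤ n + 2
  injective : Function.Injective e
  side : ∀ v : Fin (n + 3), e (Sum.inr v) = chord v (nextVertex n v)
  not_crosses : ∀ i j, ¬ Crosses (e i) (e j)
  mem_range : ∀ x : ℕ × ℕ, x.1 < x.2 → x.2 ≤ n + 2 → (∀ j, ¬ Crosses (e j) x) → x ∈ Set.range e

namespace IsTriangulation

variable {e : EdgeLabel n → ℕ × ℕ}

theorem side_mem_range (h : IsTriangulation e) {v : ℕ} (hv : v ≤ n + 2) :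
    chord v (nextVertex n v) ∈ Set.range e :=
  ⟨Sum.inr ⟨v, by omega⟩, h.side _⟩

theorem ne_of_chord_mem (h : IsTriangulation e) {a b : ℕ} (hab : chord a b ∈ Set.range e) :
    a ≠ b := by
  obtain ⟨j, hj⟩ := hab
  have := h.lt j
  simp only [hj, chord] at this
  omega

theorem le_of_chord_mem (h : IsTriangulation e) {a b : ℕ} (hab : chord a b ∈ Set.range e) :
    b ≤ n + 2 := by
  obtain ⟨j, hj⟩ := hab
  have := h.le j
  simp only [hj, chord] at this
  omega

theorem chord_mem_range (h : IsTriangulation e) {a b : ℕ} (ha : a ≤ n + 2) (hb : b ≤ n + 2)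
    (hab : a ≠ b) (hcross : ∀ j, ¬ Crosses (e j) (chord a b)) : chord a b ∈ Set.range e :=
  h.mem_range _ (by simp only [chord]; omega) (by simp only [chord]; omega) hcross

theorem exists_last_neighbor (h : IsTriangulation e) {a c : ℕ} (ha : a ≤ n + 2)
    (hac : sbtw a (nextVertex n a) c) :
    ∃ b, sbtw a b c ∧ chord a b ∈ Set.range e ∧
      ∀ s, sbtw b s c → chord a s ∉ Set.range e := by
  let dist (b : ℕ) : ℕ := if a < b then b else b + (n + 3)
  let neighbors : Set ℕ := {b | sbtw a b c ∧ chord a b ∈ Set.range e}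
  have hfin : neighbors.Finite :=
    (Set.finite_Iic (n + 2)).subset fun b hb => h.le_of_chord_mem hb.2
  obtain ⟨b, ⟨hb, hab⟩, hmax⟩ :=
    hfin.exists_maximalFor dist neighbors ⟨_, hac, h.side_mem_range ha⟩
  refine ⟨b, hb, hab, fun s hs has => ?_⟩
  have hsc : sbtw a s c := by
    simp only [sbtw_iff] at *
    omega
  have hle := hmax ⟨hsc, has⟩
  have hb' := h.le_of_chord_mem hab
  simp only [dist, sbtw_iff] at *
  split_ifs at hle <;> omega

theorem exists_apex (h : IsTriangulation e) {a v c : ℕ} (hac : chord a c ∈ Set.range e)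
    (hv : v ≤ n + 2) (havc : sbtw a v c) :
    ∃ b, sbtw a b c ∧ chord a b ∈ Set.range e ∧ chord b c ∈ Set.range e := by
  have ha : a ≤ n + 2 := h.le_of_chord_mem (chord_comm a c ▸ hac)
  obtain ⟨b, hb, hab, hlast⟩ := h.exists_last_neighbor ha (sbtw_nextVertex hv havc)
  refine ⟨b, hb, hab, h.chord_mem_range (h.le_of_chord_mem hab) (h.le_of_chord_mem hac)
    (by simp only [sbtw_iff] at hb; omega) fun j hj => ?_⟩
  obtain ⟨i, hi⟩ := hab
  obtain ⟨k, hk⟩ := hac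
  obtain ⟨s, hs, hjs⟩ := exists_eq_chord_of_crosses hb hj (hi ▸ h.not_crosses j i)
    (hk ▸ h.not_crosses j k)
  exact hlast s hs ⟨j, hjs⟩

theorem exists_quadrilateral (h : IsTriangulation e) (k : Fin n) :
    ∃ a b c d, CyclicallyOrdered a b c d ∧ e (Sum.inl k) = chord a c ∧
      chord a b ∈ Set.range e ∧ chord b c ∈ Set.range e ∧
      chord c d ∈ Set.range e ∧ chord d a ∈ Set.range e := by
  obtain ⟨a, c, hac⟩ : ∃ a c, e (Sum.inl k) = chord a c := ⟨_, _, (chord_of_lt (h.lt _)).symm⟩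
  have not_side : ∀ v ≤ n + 2, chord v (nextVertex n v) ≠ chord a c := fun v hv heq =>
    Sum.inr_ne_inl (h.injective ((h.side ⟨v, by omega⟩).trans (heq.trans hac.symm)))
  have mem_ac : chord a c ∈ Set.range e := ⟨_, hac⟩
  have mem_ca : chord c a ∈ Set.range e := chord_comm a c ▸ mem_ac
  have hne := h.ne_of_chord_mem mem_ac
  have ha := h.le_of_chord_mem mem_ca
  have hc := h.le_of_chord_mem mem_ac
  obtain ⟨b, habc, hab, hbc⟩ := h.exists_apex mem_ac (nextVertex_le ha)
    (sbtw_nextVertex_of_ne hc hne fun heq => not_side a ha (by rw [heq]))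
  obtain ⟨d, hcda, hcd, hda⟩ := h.exists_apex mem_ca (nextVertex_le hc)
    (sbtw_nextVertex_of_ne ha hne.symm fun heq => not_side c hc (by rw [heq, chord_comm]))
  exact ⟨a, b, c, d, ⟨habc, hcda.cyclic_right⟩, hac, hab, hbc, hcd, hda⟩

theorem exists_crossed_triangle (h : IsTriangulation e) {u v : ℕ} (hu : u ≤ n + 2)
    (hv : v ≤ n + 2) (huv : u ≠ v) (hmem : chord u v ∉ Set.range e) :
    ∃ b d, CyclicallyOrdered u b v d ∧ chord u b ∈ Set.range e ∧ chord b d ∈ Set.range e ∧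
      chord d u ∈ Set.range e := by
  have hnext : nextVertex n u ≠ v := fun heq => hmem (heq ▸ h.side_mem_range hu)
  obtain ⟨b, hub, hub_mem, hlast⟩ :=
    h.exists_last_neighbor hu (sbtw_nextVertex_of_ne hv huv hnext)
  obtain ⟨d, hd, hbd, hdu⟩ := h.exists_apex (chord_comm u b ▸ hub_mem) hv hub.cyclic_left
  have hdv : d ≠ v := fun heq => hmem (by rwa [chord_comm, ← heq])
  have hd_not : ¬ sbtw b d v := fun hbdv => hlast d hbdv (chord_comm d u ▸ hdu)
  refine ⟨b, d, ⟨hub, ?_⟩, hub_mem, hbd, hdu⟩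
  simp only [sbtw_iff] at *
  omega

end IsTriangulation

/-- In a triangle whose third side lies in `E`, the chord `y` follows the chord `x` in
the cyclic order of the boundary: this is an arrow `x → y` of the quiver of a triangulation `E`. -/
def Arrow (E : Set (ℕ × ℕ)) (x y : ℕ × ℕ) : Prop :=
  ∃ u v w, sbtw u v w ∧ chord u v = x ∧ chord v w = y ∧ chord w u ∈ E

theorem arrow_chord_iff {E : Set (ℕ × ℕ)} {a v b : ℕ} (hab : a ≠ b) :
    Arrow E (chord a v) (chord v b) ↔ sbtw a v b ∧ chord b a ∈ E := by
  refine ⟨?_, fun ⟨h, hE⟩ => ⟨a, v, b, h, rfl, rfl, hE⟩⟩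
  rintro ⟨u', v', w', h, hx, hy, hE⟩
  rw [chord_eq_chord_iff] at hx hy
  obtain ⟨rfl, rfl, rfl⟩ : u' = a ∧ v' = v ∧ w' = b := by
    simp only [sbtw_iff] at h
    omega
  exact ⟨h, hE⟩

open scoped Classical in
/-- The entry of the signed adjacency matrix of a triangulation `E` at the chords `x`, `y`. -/
def adjacency (E : Set (ℕ × ℕ)) (x y : ℕ × ℕ) : ℤ :=
  (if Arrow E x y then 1 else 0) - if Arrow E y x then 1 else 0

theorem adjacency_swap (E : Set (ℕ × ℕ)) (x y : ℕ × ℕ) :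
    adjacency E y x = - adjacency E x y :=
  (neg_sub _ _).symm

theorem adjacency_self (E : Set (ℕ × ℕ)) (x : ℕ × ℕ) : adjacency E x x = 0 :=
  sub_self _

/-- `S` contains the four sides of the quadrilateral `abcd` and no chord that crosses one of its
diagonals. -/
structure IsQuadrilateral (S : Set (ℕ × ℕ)) (a b c d : ℕ) : Prop where
  ordered : CyclicallyOrdered a b c d
  ab_mem : chord a b ∈ S
  bc_mem : chord b c ∈ S
  cd_mem : chord c d ∈ S
  da_mem : chord d a ∈ S
  not_crosses_ac : ∀ x ∈ S, ¬ Crosses x (chord a c)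
  not_crosses_bd : ∀ x ∈ S, ¬ Crosses x (chord b d)

/-- The indicator function of the opposite sides `ab` and `cd` of the quadrilateral `abcd`. -/
def oppositeSides (a b c d : ℕ) : ℕ × ℕ → ℤ :=
  Pi.single (chord a b) 1 + Pi.single (chord c d) 1

theorem oppositeSides_nonneg (a b c d : ℕ) (x : ℕ × ℕ) : 0 ≤ oppositeSides a b c d x := by
  simp only [oppositeSides, Pi.add_apply, Pi.single_apply]
  split_ifs <;> norm_num

theorem oppositeSides_swap (a b c d : ℕ) : oppositeSides c d a b = oppositeSides a b c d :=
  add_comm _ _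

namespace IsQuadrilateral

variable {S : Set (ℕ × ℕ)} {a b c d : ℕ} {x y : ℕ × ℕ}

theorem rotate (h : IsQuadrilateral S a b c d) : IsQuadrilateral S b c d a where
  ordered := h.ordered.rotate
  ab_mem := h.bc_mem
  bc_mem := h.cd_mem
  cd_mem := h.da_mem
  da_mem := h.ab_mem
  not_crosses_ac := h.not_crosses_bd
  not_crosses_bd := chord_comm a c ▸ h.not_crosses_ac

theorem ac_notMem (h : IsQuadrilateral S a b c d) : chord a c ∉ S := fun hac =>
  h.not_crosses_bd _ hac h.ordered.crosses

theorem apex_unique (h : IsQuadrilateral S a b c d) {v : ℕ} (hv : sbtw a v c)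
    (hav : chord a v ∈ S) (hvc : chord v c ∈ S) : v = b := by
  have hav' := h.not_crosses_bd _ hav
  have hvc' := h.not_crosses_bd _ hvc
  have hord := h.ordered
  simp only [CyclicallyOrdered, sbtw_iff, Crosses, chord] at *
  omega

theorem mem_of_mem_insert_ac {u v : ℕ} (huv : chord u v ∈ insert (chord a c) S)
    (hne : ¬ (u = a ∧ v = c ∨ u = c ∧ v = a)) : chord u v ∈ S :=
  huv.resolve_left (mt chord_eq_chord_iff.1 hne)

theorem arrow_to_diagonal_iff (h : IsQuadrilateral S a b c d) (hx : x ∈ S) :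
    Arrow (insert (chord a c) S) x (chord a c) ↔ x = chord b c ∨ x = chord d a := by
  constructor
  · rintro ⟨u, v, w, huvw, rfl, hvw, hwu⟩
    have hwu' : chord w u ∈ S := mem_of_mem_insert_ac hwu <| by
      rw [chord_eq_chord_iff] at hvw
      simp only [sbtw_iff] at huvw
      omega
    rcases chord_eq_chord_iff.1 hvw with ⟨rfl, rfl⟩ | ⟨rfl, rfl⟩
    · exact .inr (by rw [h.rotate.rotate.apex_unique huvw.cyclic_right hwu' hx])
    · exact .inl (by rw [h.apex_unique huvw.cyclic_right hwu' hx])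
  · rintro (rfl | rfl)
    · exact ⟨b, c, a, h.ordered.1.cyclic_left, rfl, chord_comm c a, .inr h.ab_mem⟩
    · exact ⟨d, a, c, h.ordered.2.cyclic_right, rfl, rfl, .inr h.cd_mem⟩

theorem arrow_from_diagonal_iff (h : IsQuadrilateral S a b c d) (hx : x ∈ S) :
    Arrow (insert (chord a c) S) (chord a c) x ↔ x = chord a b ∨ x = chord c d := by
  constructor
  · rintro ⟨u, v, w, huvw, huv, rfl, hwu⟩
    have hwu' : chord w u ∈ S := mem_of_mem_insert_ac hwu <| by
      rw [chord_eq_chord_iff] at huv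
      simp only [sbtw_iff] at huvw
      omega
    rcases chord_eq_chord_iff.1 huv with ⟨rfl, rfl⟩ | ⟨rfl, rfl⟩
    · exact .inr (by rw [h.rotate.rotate.apex_unique huvw.cyclic_left hx hwu'])
    · exact .inl (by rw [h.apex_unique huvw.cyclic_left hx hwu'])
  · rintro (rfl | rfl)
    · exact ⟨c, a, b, h.ordered.1.cyclic_right, chord_comm c a, rfl, .inr h.bc_mem⟩
    · exact ⟨a, c, d, h.ordered.2, rfl, rfl, .inr h.da_mem⟩

theorem arrow_insert_iff (h : IsQuadrilateral S a b c d) (hx : x ∈ S) (hy : y ∈ S) :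
    Arrow (insert (chord a c) S) x y ↔
      Arrow S x y ∨ x = chord a b ∧ y = chord b c ∨ x = chord c d ∧ y = chord d a := by
  constructor
  · rintro ⟨u, v, w, huvw, rfl, rfl, hwu⟩
    rcases hwu with hwu | hwu
    · rcases chord_eq_chord_iff.1 hwu with ⟨rfl, rfl⟩ | ⟨rfl, rfl⟩
      · exact .inr (.inr (by simp only [h.rotate.rotate.apex_unique huvw hx hy, and_self]))
      · exact .inr (.inl (by simp only [h.apex_unique huvw hx hy, and_self]))
    · exact .inl ⟨u, v, w, huvw, rfl, rfl, hwu⟩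
  · rintro (⟨u, v, w, huvw, rfl, rfl, hwu⟩ | ⟨rfl, rfl⟩ | ⟨rfl, rfl⟩)
    · exact ⟨u, v, w, huvw, rfl, rfl, .inr hwu⟩
    · exact ⟨a, b, c, h.ordered.1, rfl, rfl, .inl (chord_comm c a)⟩
    · exact ⟨c, d, a, h.ordered.2.cyclic_left, rfl, rfl, .inl rfl⟩

theorem not_arrow_ab_bc (h : IsQuadrilateral S a b c d) :
    ¬ Arrow S (chord a b) (chord b c) := fun harrow => by
  have hac : a ≠ c := by
    have hord := h.ordered.1
    simp only [sbtw_iff] at hord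
    omega
  exact h.ac_notMem (chord_comm c a ▸ ((arrow_chord_iff hac).1 harrow).2)

theorem ab_ne_cd (h : IsQuadrilateral S a b c d) : chord a b ≠ chord c d := by
  have hord := h.ordered
  rw [Ne, chord_eq_chord_iff]
  simp only [CyclicallyOrdered, sbtw_iff] at hord
  omega

open scoped Classical in
theorem ite_eq_oppositeSides (h : IsQuadrilateral S a b c d) (x : ℕ × ℕ) :
    (if x = chord a b ∨ x = chord c d then 1 else 0 : ℤ) = oppositeSides a b c d x := by
  have hne := h.ab_ne_cd
  simp only [oppositeSides, Pi.add_apply, Pi.single_apply]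
  grind

theorem adjacency_diagonal (h : IsQuadrilateral S a b c d) (hx : x ∈ S) :
    adjacency (insert (chord a c) S) x (chord a c) =
      oppositeSides b c d a x - oppositeSides a b c d x := by
  classical
  simp only [adjacency, h.arrow_to_diagonal_iff hx, h.arrow_from_diagonal_iff hx]
  rw [h.ite_eq_oppositeSides, h.rotate.ite_eq_oppositeSides]

theorem max_adjacency_diagonal (h : IsQuadrilateral S a b c d) (hx : x ∈ S) :
    max (adjacency (insert (chord a c) S) x (chord a c)) 0 = oppositeSides b c d a x := by
  have hdisjoint : oppositeSides a b c d x = 0 ∨ oppositeSides b c d a x = 0 := by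
    have hord := h.ordered
    rw [← h.ite_eq_oppositeSides, ← h.rotate.ite_eq_oppositeSides]
    simp only [CyclicallyOrdered, sbtw_iff] at hord
    obtain ⟨p, q⟩ := x
    simp only [chord, Prod.mk.injEq, ite_eq_right_iff, one_ne_zero, imp_false]
    omega
  have := oppositeSides_nonneg a b c d x
  have := oppositeSides_nonneg b c d a x
  rw [h.adjacency_diagonal hx]
  omega

theorem max_neg_adjacency_diagonal (h : IsQuadrilateral S a b c d) (hx : x ∈ S) :
    max (-adjacency (insert (chord a c) S) x (chord a c)) 0 = oppositeSides a b c d x := by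
  have hmax := h.max_adjacency_diagonal hx
  rw [h.adjacency_diagonal hx] at *
  omega

open scoped Classical in
theorem ite_arrow_insert (h : IsQuadrilateral S a b c d) (hx : x ∈ S) (hy : y ∈ S) :
    (if Arrow (insert (chord a c) S) x y then 1 else 0 : ℤ) =
      (if Arrow S x y then 1 else 0) +
        ((Pi.single (chord a b) 1 : ℕ × ℕ → ℤ) x * (Pi.single (chord b c) 1 : ℕ × ℕ → ℤ) y +
          (Pi.single (chord c d) 1 : ℕ × ℕ → ℤ) x * (Pi.single (chord d a) 1 : ℕ × ℕ → ℤ) y) := by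
  have habc := h.not_arrow_ab_bc
  have hcda := h.rotate.rotate.not_arrow_ab_bc
  have hne := h.ab_ne_cd
  simp only [h.arrow_insert_iff hx hy, Pi.single_apply]
  grind

theorem adjacency_flip (h : IsQuadrilateral S a b c d) (hx : x ∈ S) (hy : y ∈ S) :
    adjacency (insert (chord b d) S) x y =
      adjacency (insert (chord a c) S) x y +
        (oppositeSides b c d a x * oppositeSides a b c d y -
          oppositeSides a b c d x * oppositeSides b c d a y) := by
  simp only [adjacency, h.ite_arrow_insert hx hy, h.ite_arrow_insert hy hx,
    h.rotate.ite_arrow_insert hx hy, h.rotate.ite_arrow_insert hy hx, oppositeSides, Pi.add_apply]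
  ring

end IsQuadrilateral

section Mutation

variable {J : Type*}

/-- Matrix mutation in direction `k` for an arbitrary index type. -/
def matrixMutation [DecidableEq J] (k : J) (M : Matrix J J ℤ) : Matrix J J ℤ :=
  Matrix.of fun i j =>
    if i = k ∨ j = k then - M i j
    else M i j + max (M i k) 0 * M k j + M i k * max (-M k j) 0

theorem mutateMatrix_eq_matrixMutation (k : Fin n) (B : Matrix (Fin n) (Fin n) ℤ) :
    mutateMatrix k B = matrixMutation k B :=
  rfl

theorem matrixMutation_submatrix [DecidableEq J] {I : Type*} [DecidableEq I] {f : I → J}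
    (hf : Function.Injective f) (k : I) (M : Matrix J J ℤ) :
    (matrixMutation (f k) M).submatrix f f = matrixMutation k (M.submatrix f f) := by
  ext i j
  simp only [matrixMutation, Matrix.submatrix_apply, Matrix.of_apply, hf.eq_iff]

theorem matrixMutation_matrixMutation [DecidableEq J] (k : J) (M : Matrix J J ℤ) :
    matrixMutation k (matrixMutation k M) = M := by
  ext i j
  by_cases hij : i = k ∨ j = k
  · simp only [matrixMutation, Matrix.of_apply, hij, if_true, neg_neg]
  · have hi : max (-M i k) 0 = max (M i k) 0 - M i k := by omega
    have hj : max (M k j) 0 = max (-M k j) 0 + M k j := by omega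
    simp only [matrixMutation, Matrix.of_apply, hij, if_false, true_or, or_true, if_true, neg_neg,
      hi, hj]
    ring

/-- The Laurent monomial in the family `g` whose exponents form the column `k` of `M`; applied to
a family of coefficients or cluster variables, this is the `ŷ`-variable in direction `k`. -/
def columnMonomial {G : Type*} [CommGroup G] [Fintype J] (g : J → G) (M : Matrix J J ℤ) (k : J) :
    G :=
  ∏ i, g i ^ M i k

section ColumnMonomial

variable {G : Type*} [CommGroup G] [Fintype J]

theorem columnMonomial_eq_div (g : J → G) (M : Matrix J J ℤ) (k : J) :
    columnMonomial g M k = (∏ i, g i ^ max (M i k) 0) / ∏ i, g i ^ max (-M i k) 0 := by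
  rw [columnMonomial, ← Finset.prod_div_distrib]
  refine Finset.prod_congr rfl fun i _ => ?_
  rw [div_eq_mul_inv, ← zpow_sub]
  congr 1
  omega

variable [DecidableEq J] {M : Matrix J J ℤ} {k : J}

theorem columnMonomial_update_matrixMutation_self (g : J → G) (x : G) (hM : M k k = 0) :
    columnMonomial (Function.update g k x) (matrixMutation k M) k = (columnMonomial g M k)⁻¹ := by
  rw [columnMonomial, columnMonomial, ← Finset.prod_inv_distrib]
  refine Finset.prod_congr rfl fun i _ => ?_
  rw [matrixMutation, Matrix.of_apply, if_pos (Or.inr rfl)]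
  rcases eq_or_ne i k with rfl | hi
  · rw [hM, neg_zero, zpow_zero, zpow_zero, inv_one]
  · rw [Function.update_of_ne hi, zpow_neg]

theorem columnMonomial_update_matrixMutation_of_ne {g : J → G} {x z : G} (hM : M k k = 0)
    (hx : g k * x = (∏ i, g i ^ max (-M i k) 0) * z) {j : J} (hj : j ≠ k) :
    columnMonomial (Function.update g k x) (matrixMutation k M) j =
      columnMonomial g M j * columnMonomial g M k ^ max (M k j) 0 * z ^ (-M k j) := by
  have hfactor : ∀ i, Function.update g k x i ^ matrixMutation k M i j =
      g i ^ M i j * (g i ^ M i k) ^ max (-M k j) 0 * (g i ^ max (M i k) 0) ^ M k j *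
        if i = k then (g k * x) ^ (-M k j) else 1 := by
    intro i
    rw [matrixMutation, Matrix.of_apply]
    rcases eq_or_ne i k with rfl | hi
    · simp only [true_or, if_true, Function.update_self, hM, max_self, zpow_zero, one_zpow,
        mul_one, mul_zpow, zpow_neg, mul_inv, mul_inv_cancel_left]
    · rw [if_neg (not_or.2 ⟨hi, hj⟩), if_neg hi, Function.update_of_ne hi, mul_one,
        add_right_comm, zpow_add, zpow_add, zpow_mul, zpow_mul]
  have hratio : (∏ i, g i ^ max (M i k) 0) ^ M k j * (∏ i, g i ^ max (-M i k) 0) ^ (-M k j) =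
      columnMonomial g M k ^ M k j := by
    rw [zpow_neg, ← div_eq_mul_inv, ← div_zpow, ← columnMonomial_eq_div]
  calc columnMonomial (Function.update g k x) (matrixMutation k M) j
      = columnMonomial g M j * columnMonomial g M k ^ max (-M k j) 0 *
          (∏ i, g i ^ max (M i k) 0) ^ M k j * (g k * x) ^ (-M k j) := by
        simp only [columnMonomial, hfactor, Finset.prod_mul_distrib, Finset.prod_zpow,
          Finset.prod_ite_eq', Finset.mem_univ, if_true]
    _ = columnMonomial g M j * (columnMonomial g M k ^ max (-M k j) 0 *
          ((∏ i, g i ^ max (M i k) 0) ^ M k j * (∏ i, g i ^ max (-M i k) 0) ^ (-M k j))) *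
          z ^ (-M k j) := by
        rw [hx, mul_zpow]
        simp only [mul_assoc]
    _ = columnMonomial g M j * columnMonomial g M k ^ max (M k j) 0 * z ^ (-M k j) := by
        rw [hratio, ← zpow_add]
        congr 3
        omega

end ColumnMonomial

/-- The signed adjacency matrix of a labeled family of chords. -/
def adjMatrix (e : J → ℕ × ℕ) : Matrix J J ℤ :=
  Matrix.of fun i j => adjacency (Set.range e) (e i) (e j)

theorem adjMatrix_self (e : J → ℕ × ℕ) (i : J) : adjMatrix e i i = 0 :=
  adjacency_self _ _

theorem adjMatrix_swap (e : J → ℕ × ℕ) (i j : J) : adjMatrix e j i = - adjMatrix e i j :=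
  adjacency_swap _ _ _

/-- The diagonal `ac` labeled by `k` can be flipped to `bd`. -/
structure IsFlippable (e : J → ℕ × ℕ) (k : J) (a b c d : ℕ) : Prop where
  diagonal : e k = chord a c
  quad : IsQuadrilateral (e '' {k}ᶜ) a b c d

theorem range_eq_insert (e : J → ℕ × ℕ) (k : J) :
    Set.range e = insert (e k) (e '' {k}ᶜ) := by
  rw [← Set.image_insert_eq, Set.insert_eq, Set.union_compl_self, Set.image_univ]

theorem range_update [DecidableEq J] (e : J → ℕ × ℕ) (k : J) (x : ℕ × ℕ) :
    Set.range (Function.update e k x) = insert x (e '' {k}ᶜ) := by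
  rw [range_eq_insert _ k, Function.update_self]
  exact congrArg _ (Set.image_congr fun j hj => Function.update_of_ne hj _ _)

namespace IsFlippable

variable {e : J → ℕ × ℕ} {k : J} {a b c d : ℕ}

theorem adjMatrix_apply (h : IsFlippable e k a b c d) (i j : J) :
    adjMatrix e i j = adjacency (insert (chord a c) (e '' {k}ᶜ)) (e i) (e j) := by
  rw [← h.diagonal, ← range_eq_insert]
  rfl

theorem ac_ne (h : IsFlippable e k a b c d) {x : ℕ × ℕ} (hx : x ∈ e '' {k}ᶜ) : chord a c ≠ x :=
  fun heq => h.quad.ac_notMem (heq ▸ hx)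

theorem max_adjMatrix (h : IsFlippable e k a b c d) (i : J) :
    max (adjMatrix e i k) 0 = oppositeSides b c d a (e i) := by
  rcases eq_or_ne i k with rfl | hi
  · rw [adjMatrix_self, h.diagonal, oppositeSides, Pi.add_apply,
      Pi.single_eq_of_ne (h.ac_ne h.quad.bc_mem), Pi.single_eq_of_ne (h.ac_ne h.quad.da_mem)]
    rfl
  · rw [h.adjMatrix_apply, h.diagonal,
      h.quad.max_adjacency_diagonal (Set.mem_image_of_mem e hi)]

theorem max_neg_adjMatrix (h : IsFlippable e k a b c d) (i : J) :
    max (-adjMatrix e i k) 0 = oppositeSides a b c d (e i) := by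
  rcases eq_or_ne i k with rfl | hi
  · rw [adjMatrix_self, h.diagonal, oppositeSides, Pi.add_apply,
      Pi.single_eq_of_ne (h.ac_ne h.quad.ab_mem), Pi.single_eq_of_ne (h.ac_ne h.quad.cd_mem)]
    rfl
  · rw [h.adjMatrix_apply, h.diagonal,
      h.quad.max_neg_adjacency_diagonal (Set.mem_image_of_mem e hi)]

theorem adjMatrix_update_diagonal [DecidableEq J] (h : IsFlippable e k a b c d) {i : J}
    (hi : i ≠ k) : adjMatrix (Function.update e k (chord b d)) i k = - adjMatrix e i k := by
  have hmem : e i ∈ e '' {k}ᶜ := Set.mem_image_of_mem e hi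
  rw [h.adjMatrix_apply, adjMatrix, Matrix.of_apply, range_update, Function.update_self,
    Function.update_of_ne hi, h.diagonal, h.quad.adjacency_diagonal hmem,
    h.quad.rotate.adjacency_diagonal hmem, oppositeSides_swap, neg_sub]

theorem adjMatrix_update [DecidableEq J] (h : IsFlippable e k a b c d) :
    adjMatrix (Function.update e k (chord b d)) = matrixMutation k (adjMatrix e) := by
  ext i j
  rw [matrixMutation, Matrix.of_apply]
  rcases eq_or_ne i k with rfl | hi
  · rw [if_pos (.inl rfl)]
    rcases eq_or_ne j i with rfl | hj
    · rw [adjMatrix_self, adjMatrix_self, neg_zero]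
    · rw [adjMatrix_swap _ j, adjMatrix_swap _ j, h.adjMatrix_update_diagonal hj]
  rcases eq_or_ne j k with rfl | hj
  · rw [if_pos (.inr rfl), h.adjMatrix_update_diagonal hi]
  have hi_mem : e i ∈ e '' {k}ᶜ := Set.mem_image_of_mem e hi
  have hj_mem : e j ∈ e '' {k}ᶜ := Set.mem_image_of_mem e hj
  have hik : adjMatrix e i k = oppositeSides b c d a (e i) - oppositeSides a b c d (e i) := by
    rw [h.adjMatrix_apply, h.diagonal, h.quad.adjacency_diagonal hi_mem]
  have hjk : adjMatrix e j k = oppositeSides b c d a (e j) - oppositeSides a b c d (e j) := by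
    rw [h.adjMatrix_apply, h.diagonal, h.quad.adjacency_diagonal hj_mem]
  have hij : adjMatrix (Function.update e k (chord b d)) i j =
      adjacency (insert (chord b d) (e '' {k}ᶜ)) (e i) (e j) := by
    rw [adjMatrix, Matrix.of_apply, range_update, Function.update_of_ne hi,
      Function.update_of_ne hj]
  rw [if_neg (not_or.2 ⟨hi, hj⟩), h.max_adjMatrix, adjMatrix_swap e j k, neg_neg, h.max_adjMatrix,
    hij, h.quad.adjacency_flip hi_mem hj_mem, ← h.adjMatrix_apply, hik, hjk]
  ring

end IsFlippable

end Mutation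

theorem CyclicallyOrdered.eq_chord_of_crosses {a b c d : ℕ} {x : ℕ × ℕ}
    (h : CyclicallyOrdered a b c d) (hac : Crosses x (chord a c)) (hab : ¬ Crosses x (chord a b))
    (hbc : ¬ Crosses x (chord b c)) (hcd : ¬ Crosses x (chord c d))
    (hda : ¬ Crosses x (chord d a)) : x = chord b d := by
  obtain ⟨s, hs, rfl⟩ := exists_eq_chord_of_crosses h.1.cyclic_left (chord_comm a c ▸ hac) hbc
    (chord_comm a b ▸ hab)
  have hsd : s = d := by
    clear hac hab hbc
    simp only [CyclicallyOrdered, sbtw_iff, Crosses, chord] at *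
    omega
  rw [hsd]

theorem injective_update {α β : Type*} [DecidableEq α] {f : α → β} {a : α} {b : β}
    (hf : Function.Injective f) (hb : ∀ i ≠ a, f i ≠ b) :
    Function.Injective (Function.update f a b) := by
  intro i j hij
  grind [Function.update_apply, hf.eq_iff]

namespace IsTriangulation

variable {e : EdgeLabel n → ℕ × ℕ} {k : Fin n} {a b c d : ℕ}

theorem exists_isFlippable (h : IsTriangulation e) (k : Fin n) :
    ∃ a b c d, IsFlippable e (Sum.inl k) a b c d := by
  obtain ⟨a, b, c, d, hord, hk, hab, hbc, hcd, hda⟩ := h.exists_quadrilateral k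
  have side_mem {u v : ℕ} (huv : chord u v ∈ Set.range e)
      (hne : ¬ (u = a ∧ v = c ∨ u = c ∧ v = a)) : chord u v ∈ e '' {Sum.inl k}ᶜ :=
    (range_eq_insert e (Sum.inl k) ▸ huv).resolve_left (hk ▸ mt chord_eq_chord_iff.1 hne)
  have not_crosses {u v : ℕ} (huv : chord u v ∈ Set.range e) (j) :
      ¬ Crosses (e j) (chord u v) := by
    obtain ⟨i, hi⟩ := huv
    exact hi ▸ h.not_crosses j i
  refine ⟨a, b, c, d, hk, hord, side_mem hab ?_, side_mem hbc ?_, side_mem hcd ?_,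
    side_mem hda ?_, ?_, ?_⟩
  iterate 4
    simp only [CyclicallyOrdered, sbtw_iff] at hord
    omega
  · rintro _ ⟨j, -, rfl⟩
    exact hk ▸ h.not_crosses j _
  · rintro _ ⟨j, hj, rfl⟩ hcross
    have hjk : e j = chord c a := hord.rotate.eq_chord_of_crosses hcross (not_crosses hbc j)
      (not_crosses hcd j) (not_crosses hda j) (not_crosses hab j)
    exact hj (h.injective (hjk.trans (hk.trans (chord_comm a c)).symm))

theorem mem_range_update (h : IsTriangulation e) (hf : IsFlippable e (Sum.inl k) a b c d)
    {x : ℕ × ℕ} (hlt : x.1 < x.2) (hle : x.2 ≤ n + 2)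
    (hx : ∀ j, ¬ Crosses (Function.update e (Sum.inl k) (chord b d) j) x) :
    x ∈ Set.range (Function.update e (Sum.inl k) (chord b d)) := by
  have hord := hf.quad.ordered
  obtain ⟨hxbd, hx⟩ := (Function.forall_update_iff e fun _ y => ¬ Crosses y x).1 hx
  rw [range_update]
  by_cases hxac : Crosses (e (Sum.inl k)) x
  · have not_crosses (y) (hy : y ∈ e '' {Sum.inl k}ᶜ) : ¬ Crosses x y := by
      obtain ⟨j, hj, rfl⟩ := hy
      exact mt crosses_comm.1 (hx j hj)
    exact .inl <| hord.eq_chord_of_crosses (hf.diagonal ▸ crosses_comm.1 hxac)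
      (not_crosses _ hf.quad.ab_mem) (not_crosses _ hf.quad.bc_mem)
      (not_crosses _ hf.quad.cd_mem) (not_crosses _ hf.quad.da_mem)
  · have hmem : x ∈ Set.range e := h.mem_range x hlt hle fun j =>
      if hj : j = Sum.inl k then hj ▸ hxac else hx j hj
    rw [range_eq_insert e (Sum.inl k)] at hmem
    refine .inr (hmem.resolve_left ?_)
    rintro rfl
    exact hxbd (crosses_comm.1 (hf.diagonal ▸ hord.crosses))

theorem flip (h : IsTriangulation e) (hf : IsFlippable e (Sum.inl k) a b c d) :
    IsTriangulation (Function.update e (Sum.inl k) (chord b d)) := by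
  have hb : b ≤ n + 2 := h.le_of_chord_mem (Set.image_subset_range _ _ hf.quad.ab_mem)
  have hd : d ≤ n + 2 := h.le_of_chord_mem (Set.image_subset_range _ _ hf.quad.cd_mem)
  have hord := hf.quad.ordered
  have hcross (i) (hi : i ≠ Sum.inl k) : ¬ Crosses (e i) (chord b d) :=
    hf.quad.not_crosses_bd _ ⟨i, hi, rfl⟩
  have hself : ¬ Crosses (chord b d) (chord b d) := by
    simp only [Crosses, lt_irrefl, and_false, or_self, not_false_eq_true]
  refine ⟨?_, ?_, ?_, fun v => ?_, ?_, fun x hlt hle hx => ?_⟩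
  · refine (Function.forall_update_iff e fun _ y => y.1 < y.2).2 ⟨?_, fun j _ => h.lt j⟩
    simp only [CyclicallyOrdered, sbtw_iff, chord] at *
    omega
  · exact (Function.forall_update_iff e fun _ y => y.2 ≤ n + 2).2 ⟨max_le hb hd, fun j _ => h.le j⟩
  · exact injective_update h.injective fun i hi heq =>
      hf.quad.rotate.ac_notMem (heq ▸ ⟨i, hi, rfl⟩)
  · rw [Function.update_of_ne Sum.inr_ne_inl]
    exact h.side v
  · refine (Function.forall_update_iff e fun _ y =>
      ∀ j, ¬ Crosses y (Function.update e (Sum.inl k) (chord b d) j)).2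
      ⟨(Function.forall_update_iff e fun _ y => ¬ Crosses (chord b d) y).2
        ⟨hself, fun j hj => mt crosses_comm.1 (hcross j hj)⟩, fun i hi =>
        (Function.forall_update_iff e fun _ y => ¬ Crosses (e i) y).2
          ⟨hcross i hi, fun j _ => h.not_crosses i j⟩⟩
  · exact h.mem_range_update hf hlt hle hx

end IsTriangulation

/-- `B` is the signed adjacency matrix of the diagonals of a triangulation of the
`(n + 3)`-gon. -/
def IsPolygonMatrix (B : Matrix (Fin n) (Fin n) ℤ) : Prop :=
  ∃ e : EdgeLabel n → ℕ × ℕ, IsTriangulation e ∧ (adjMatrix e).submatrix Sum.inl Sum.inl = B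

theorem IsFlippable.submatrix_adjMatrix_update {e : EdgeLabel n → ℕ × ℕ} {k : Fin n}
    {a b c d : ℕ} (hf : IsFlippable e (Sum.inl k) a b c d) :
    (adjMatrix (Function.update e (Sum.inl k) (chord b d))).submatrix Sum.inl Sum.inl =
      mutateMatrix k ((adjMatrix e).submatrix Sum.inl Sum.inl) := by
  rw [hf.adjMatrix_update, matrixMutation_submatrix Sum.inl_injective,
    mutateMatrix_eq_matrixMutation]

theorem IsPolygonMatrix.mutate {B : Matrix (Fin n) (Fin n) ℤ} (hB : IsPolygonMatrix B)
    (k : Fin n) : IsPolygonMatrix (mutateMatrix k B) := by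
  obtain ⟨e, he, rfl⟩ := hB
  obtain ⟨a, b, c, d, hf⟩ := he.exists_isFlippable k
  exact ⟨_, he.flip hf, hf.submatrix_adjMatrix_update⟩

theorem IsPolygonMatrix.submatrix {B : Matrix (Fin n) (Fin n) ℤ} (hB : IsPolygonMatrix B)
    (τ : Equiv.Perm (Fin n)) : IsPolygonMatrix (B.submatrix τ τ) := by
  obtain ⟨e, he, rfl⟩ := hB
  have hrange : Set.range (e ∘ Sum.map τ id) = Set.range e :=
    (Sum.map_surjective.2 ⟨τ.surjective, Function.surjective_id⟩).range_comp e
  refine ⟨e ∘ Sum.map τ id, ⟨fun j => he.lt _, fun j => he.le _,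
    he.injective.comp (τ.injective.sumMap Function.injective_id), he.side,
    fun i j => he.not_crosses _ _, fun x hlt hle hx => ?_⟩, ?_⟩
  · rw [hrange]
    refine he.mem_range x hlt hle fun j => ?_
    obtain ⟨j, rfl⟩ := (Sum.map_surjective.2 ⟨τ.surjective, Function.surjective_id⟩) j
    exact hx j
  · ext i j
    simp only [adjMatrix, hrange]
    rfl

theorem seedAt_concat (B : Matrix (Fin n) (Fin n) ℤ) (w : List (Fin n)) (k : Fin n) :
    seedAt B (w ++ [k]) = (seedAt B w).mutate k :=
  List.foldl_concat ..

theorem isPolygonMatrix_of_seedAt {B : Matrix (Fin n) (Fin n) ℤ} {w : List (Fin n)}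
    (h : IsPolygonMatrix (seedAt B w).B) : IsPolygonMatrix B := by
  induction w using List.reverseRecOn with
  | nil => exact h
  | append_singleton w k ih =>
    have hmutate := h.mutate k
    rw [seedAt_concat, Seed.mutate, mutateMatrix_eq_matrixMutation, mutateMatrix_eq_matrixMutation,
      matrixMutation_matrixMutation] at hmutate
    exact ih hmutate

theorem IsSkewSymmetrizable.mutate {B : Matrix (Fin n) (Fin n) ℤ} (h : IsSkewSymmetrizable B)
    (k : Fin n) : IsSkewSymmetrizable (mutateMatrix k B) := by
  obtain ⟨d, hd, hskew⟩ := h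
  have hmax (i j : Fin n) : d i * max (B i j) 0 = d j * max (-B j i) 0 := by
    rw [mul_max_of_nonneg _ _ (hd i).le, mul_max_of_nonneg _ _ (hd j).le, hskew, mul_neg,
      mul_zero, mul_zero]
  refine ⟨d, hd, fun i j => ?_⟩
  simp only [mutateMatrix, Matrix.of_apply, or_comm (a := j = k)]
  split_ifs
  · linear_combination - hskew i j
  · linear_combination hskew i j + B k j * hmax i k + max (-B k j) 0 * hskew i k +
      max (-B k i) 0 * hskew k j + B k i * hmax j k

theorem isSkewSymmetrizable_seedAt {B : Matrix (Fin n) (Fin n) ℤ} (h : IsSkewSymmetrizable B)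
    (w : List (Fin n)) : IsSkewSymmetrizable (seedAt B w).B := by
  induction w using List.reverseRecOn with
  | nil => exact h
  | append_singleton w k ih =>
    rw [seedAt_concat]
    exact ih.mutate k

theorem IsSkewSymmetrizable.submatrix {B : Matrix (Fin n) (Fin n) ℤ}
    (h : IsSkewSymmetrizable B) (τ : Fin n → Fin n) : IsSkewSymmetrizable (B.submatrix τ τ) :=
  let ⟨d, hd, hskew⟩ := h
  ⟨d ∘ τ, fun i => hd (τ i), fun i j => hskew (τ i) (τ j)⟩

theorem IsSkewSymmetrizable.apply_self {B : Matrix (Fin n) (Fin n) ℤ}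
    (h : IsSkewSymmetrizable B) (i : Fin n) : B i i = 0 := by
  obtain ⟨d, hd, hskew⟩ := h
  have hzero : d i * B i i = 0 := by linarith only [hskew i i]
  exact (mul_eq_zero.1 hzero).resolve_left (hd i).ne'

theorem IsSkewSymmetrizable.apply_swap {B : Matrix (Fin n) (Fin n) ℤ}
    (h : IsSkewSymmetrizable B) {i j : Fin n} (habs : |B i j| = |B j i|) : B j i = - B i j := by
  obtain ⟨d, hd, hskew⟩ := h
  rcases abs_eq_abs.1 habs with heq | hneg
  · have hsum : (d i + d j) * B i j = 0 := by linear_combination hskew i j + d j * heq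
    have hzero := (mul_eq_zero.1 hsum).resolve_left (add_pos (hd i) (hd j)).ne'
    rw [← heq, hzero, neg_zero]
  · rw [hneg, neg_neg]

theorem chord_nextVertex_cases {v : ℕ} (hv : v ≤ n + 2) :
    chord v (nextVertex n v) = (v, v + 1) ∧ v < n + 2 ∨
      chord v (nextVertex n v) = (0, n + 2) ∧ v = n + 2 := by
  unfold nextVertex chord
  split_ifs <;> simp only [Prod.mk.injEq] <;> omega

theorem not_crosses_side {v : ℕ} {x : ℕ × ℕ} (hv : v ≤ n + 2) (hx : x.2 ≤ n + 2) :
    ¬ Crosses x (chord v (nextVertex n v)) := by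
  rcases chord_nextVertex_cases hv with ⟨h, -⟩ | ⟨h, -⟩ <;> simp only [h, Crosses] <;> omega

theorem adjacency_eq_one {E : Set (ℕ × ℕ)} {a v b : ℕ} (h : sbtw a v b) (hba : chord b a ∈ E) :
    adjacency E (chord a v) (chord v b) = 1 := by
  have hab : b ≠ a := fun hba => sbtw_irrefl_left_right (hba ▸ h)
  have hswap : ¬ Arrow E (chord v b) (chord a v) := by
    rw [chord_comm v b, chord_comm a v, arrow_chord_iff hab]
    exact fun hswap => h.not_sbtw hswap.1
  have harrow : Arrow E (chord a v) (chord v b) := ⟨a, v, b, h, rfl, rfl, hba⟩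
  simp only [adjacency, harrow, hswap, if_true, if_false, sub_zero]

section Snake

variable (s : ℕ → Prop) [DecidablePred s]

/-- The successive chords of a zigzag through the `(n + 3)`-gon. The zero-th one is `(1, n + 2)`,
and step `i` moves the left endpoint up if `s i` holds and the right endpoint down otherwise. -/
def snakeChord (n i : ℕ) : ℕ × ℕ := (Nat.count s i + 1, Nat.count s i + 1 + (n + 1 - i))

/-- The triangulation of the `(n + 3)`-gon whose diagonals are the chords of a zigzag. -/
def snake (n : ℕ) : EdgeLabel n → ℕ × ℕ
  | Sum.inl i => snakeChord s n i
  | Sum.inr v => chord v (nextVertex n v)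

theorem count_le_count_add {i j : ℕ} (hij : i ≤ j) :
    Nat.count s i ≤ Nat.count s j ∧ Nat.count s j ≤ Nat.count s i + (j - i) := by
  refine ⟨Nat.count_monotone s hij, ?_⟩
  obtain ⟨l, rfl⟩ := Nat.exists_eq_add_of_le hij
  rw [Nat.count_add, Nat.add_sub_cancel_left]
  exact Nat.add_le_add_left (Nat.count_le _) _

theorem snake_lt (j : EdgeLabel n) : (snake s n j).1 < (snake s n j).2 := by
  rcases j with i | v
  · simp only [snake, snakeChord]
    omega
  · rcases chord_nextVertex_cases (n := n) (v := v) (by omega) with ⟨h, _⟩ | ⟨h, _⟩ <;>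
      simp only [snake, h] <;> omega

theorem snake_le (j : EdgeLabel n) : (snake s n j).2 ≤ n + 2 := by
  rcases j with i | v
  · have := Nat.count_le s (n := i)
    simp only [snake, snakeChord]
    omega
  · rcases chord_nextVertex_cases (n := n) (v := v) (by omega) with ⟨h, _⟩ | ⟨h, _⟩ <;>
      simp only [snake, h] <;> omega

theorem snakeChord_ne_side {i v : ℕ} (hi : i < n) (hv : v ≤ n + 2) :
    snakeChord s n i ≠ chord v (nextVertex n v) := by
  rcases chord_nextVertex_cases hv with ⟨h, -⟩ | ⟨h, -⟩ <;>
    simp only [h, snakeChord, ne_eq, Prod.mk.injEq] <;> omega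

theorem snake_injective : Function.Injective (snake s n) := by
  rintro (i | v) (j | w) hij
  · simp only [snake, snakeChord, Prod.mk.injEq] at hij
    exact congrArg Sum.inl (Fin.ext (by omega))
  · exact absurd hij (snakeChord_ne_side s i.2 (by omega))
  · exact absurd hij.symm (snakeChord_ne_side s j.2 (by omega))
  · simp only [snake] at hij
    refine congrArg Sum.inr (Fin.ext ?_)
    rcases chord_nextVertex_cases (n := n) (v := v) (by omega) with ⟨hv, _⟩ | ⟨hv, _⟩ <;>
      rcases chord_nextVertex_cases (n := n) (v := w) (by omega) with ⟨hw, _⟩ | ⟨hw, _⟩ <;>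
      simp only [hv, hw, Prod.mk.injEq] at hij <;> omega

theorem snake_not_crosses (i j : EdgeLabel n) : ¬ Crosses (snake s n i) (snake s n j) := by
  rcases i with i | v
  · rcases j with j | w
    · simp only [snake, snakeChord, Crosses]
      rcases le_total (i : ℕ) j with h | h <;> have := count_le_count_add s h <;> omega
    · exact not_crosses_side (by omega) (snake_le s _)
  · exact mt crosses_comm.1 (not_crosses_side (by omega) (snake_le s j))

theorem side_mem_range_snake {v : ℕ} (hv : v < n + 2) : (v, v + 1) ∈ Set.range (snake s n) := by
  refine ⟨Sum.inr ⟨v, by omega⟩, ?_⟩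
  simp only [snake, nextVertex, hv.ne, if_false, chord]
  simp only [le_add_iff_nonneg_right, zero_le, min_eq_left, max_eq_right]

theorem snakeChord_mem_range {i : ℕ} (hi : i ≤ n) : snakeChord s n i ∈ Set.range (snake s n) := by
  rcases hi.eq_or_lt with rfl | hi
  · have := Nat.count_le s (n := i)
    rw [snakeChord, Nat.add_sub_cancel_left]
    exact side_mem_range_snake s (by omega)
  · exact ⟨Sum.inl ⟨i, hi⟩, rfl⟩

theorem mem_range_snake_or_le {x : ℕ × ℕ} (hlt : x.1 < x.2) (hle : x.2 ≤ n + 2)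
    (hx : ∀ j, ¬ Crosses (snake s n j) x) {i : ℕ} (hi : i ≤ n) :
    x ∈ Set.range (snake s n) ∨ (snakeChord s n i).1 ≤ x.1 ∧ x.2 ≤ (snakeChord s n i).2 := by
  have hcross {i : ℕ} (hi : i ≤ n) : ¬ Crosses (snakeChord s n i) x := by
    obtain ⟨j, hj⟩ := snakeChord_mem_range s hi
    exact hj ▸ hx j
  obtain ⟨p, q⟩ := x
  rw [or_iff_not_imp_right]
  induction i with
  | zero =>
    intro hnle
    obtain ⟨rfl, rfl | rfl⟩ : p = 0 ∧ (q = 1 ∨ q = n + 2) := by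
      have := hcross hi
      simp only [snakeChord, Nat.count_zero, Crosses] at *
      omega
    · exact side_mem_range_snake s (by omega)
    · exact ⟨Sum.inr (Fin.last _), by simp [snake, nextVertex, chord]⟩
  | succ i ih =>
    intro hnle
    by_cases hle_i : (snakeChord s n i).1 ≤ p ∧ q ≤ (snakeChord s n i).2
    · obtain heq | heq : (p, q) = (p, p + 1) ∨ (p, q) = snakeChord s n i := by
        have := hcross hi
        simp only [snakeChord, Nat.count_succ, Crosses, Prod.mk.injEq, true_and] at *
        split_ifs at * <;> omega
      · exact heq ▸ side_mem_range_snake s (by simp only at hle; omega)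
      · exact heq ▸ snakeChord_mem_range s (by omega)
    · exact ih (by omega) hle_i

theorem mem_range_snake {x : ℕ × ℕ} (hlt : x.1 < x.2) (hle : x.2 ≤ n + 2)
    (hx : ∀ j, ¬ Crosses (snake s n j) x) : x ∈ Set.range (snake s n) := by
  refine (mem_range_snake_or_le s hlt hle hx le_rfl).elim id fun h => ?_
  have heq : x = snakeChord s n n := by
    simp only [snakeChord] at h
    exact Prod.ext (by simp only [snakeChord]; omega) (by simp only [snakeChord]; omega)
  exact heq ▸ snakeChord_mem_range s le_rfl

theorem isTriangulation_snake : IsTriangulation (snake s n) where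
  lt := snake_lt s
  le := snake_le s
  injective := snake_injective s
  side _ := rfl
  not_crosses := snake_not_crosses s
  mem_range _ := mem_range_snake s

theorem adjMatrix_snake_succ {i j : Fin n} (hij : (i : ℕ) + 1 = j) :
    adjMatrix (snake s n) (Sum.inl i) (Sum.inl j) = if s i then -1 else 1 := by
  let L := Nat.count s i + 1
  let R := Nat.count s i + 1 + (n + 1 - i)
  have hLR : L + 2 < R := by omega
  have hR : R ≤ n + 2 := snake_le s (Sum.inl i)
  have hi : snake s n (Sum.inl i) = chord L R := (chord_of_lt (snake_lt s _)).symm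
  split_ifs with hs
  · have hj : snake s n (Sum.inl j) = chord (L + 1) R := by
      rw [← chord_of_lt (snake_lt s (Sum.inl j))]
      simp only [snake, snakeChord, ← hij, Nat.count_succ, hs, if_true]
      congr 1
      omega
    have hside : chord L (L + 1) ∈ Set.range (snake s n) := by
      rw [chord, min_eq_left (by omega), max_eq_right (by omega)]
      exact side_mem_range_snake s (by omega)
    rw [adjMatrix, Matrix.of_apply, adjacency_swap, hi, hj, chord_comm L,
      adjacency_eq_one (by simp only [sbtw_iff]; omega) hside]
  · have hj : snake s n (Sum.inl j) = chord L (R - 1) := by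
      rw [← chord_of_lt (snake_lt s (Sum.inl j))]
      simp only [snake, snakeChord, ← hij, Nat.count_succ, hs, if_false]
      congr 1
      omega
    have hside : chord (R - 1) R ∈ Set.range (snake s n) := by
      obtain ⟨r, hr⟩ : ∃ r, R = r + 1 := ⟨R - 1, by omega⟩
      rw [hr, Nat.add_sub_cancel, chord, min_eq_left (by omega), max_eq_right (by omega)]
      exact side_mem_range_snake s (by omega)
    rw [adjMatrix, Matrix.of_apply, hi, hj, chord_comm L,
      adjacency_eq_one (by simp only [sbtw_iff]; omega) hside]

theorem crosses_snakeChord_succ {i j u v w : ℕ} (hij : i + 1 < j) (hjn : j ≤ n)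
    (hi : chord u v = snakeChord s n i) (hj : chord v w = snakeChord s n j) :
    Crosses (chord w u) (snakeChord s n (i + 1)) := by
  have := count_le_count_add s (Nat.le_add_right i 1)
  have := count_le_count_add s hij.le
  simp only [chord, snakeChord, Crosses, Prod.mk.injEq] at *
  omega

theorem adjMatrix_snake_of_succ_lt {i j : Fin n} (hij : (i : ℕ) + 1 < j) :
    adjMatrix (snake s n) (Sum.inl i) (Sum.inl j) = 0 := by
  have not_mem {u v w : ℕ} (hi : chord u v = snakeChord s n i)
      (hj : chord v w = snakeChord s n j) : chord w u ∉ Set.range (snake s n) := by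
    rintro ⟨l, hl⟩
    exact snake_not_crosses s l (Sum.inl ⟨i + 1, by omega⟩)
      (hl ▸ crosses_snakeChord_succ s hij j.2.le hi hj)
  have hij' : ¬ Arrow (Set.range (snake s n)) (snakeChord s n i) (snakeChord s n j) := by
    rintro ⟨u, v, w, -, hi, hj, hwu⟩
    exact not_mem hi hj hwu
  have hji : ¬ Arrow (Set.range (snake s n)) (snakeChord s n j) (snakeChord s n i) := by
    rintro ⟨u, v, w, -, hj, hi, hwu⟩
    exact not_mem (chord_comm v w ▸ hi) (chord_comm u v ▸ hj) (chord_comm w u ▸ hwu)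
  simp only [adjMatrix, adjacency, Matrix.of_apply, snake, hij', hji, if_false, sub_self]

end Snake

theorem abs_apply_eq_of_cartanCounterpart {B : Matrix (Fin n) (Fin n) ℤ}
    (hA : cartanCounterpart B = CartanMatrix.A n) {i j : Fin n} (hij : i ≠ j) :
    |B i j| = if (i : ℕ) + 1 = j ∨ (j : ℕ) + 1 = i then 1 else 0 := by
  have happly := congrFun (congrFun hA i) j
  simp only [cartanCounterpart, Matrix.of_apply, hij, CartanMatrix.A, if_false] at happly
  split_ifs at happly ⊢ <;> omega

theorem isPolygonMatrix_of_cartanCounterpart {B : Matrix (Fin n) (Fin n) ℤ}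
    (hB : IsSkewSymmetrizable B) (hA : cartanCounterpart B = CartanMatrix.A n) :
    IsPolygonMatrix B := by
  classical
  have hswap (i j : Fin n) (hij : i ≠ j) : B j i = - B i j := hB.apply_swap <| by
    simp only [abs_apply_eq_of_cartanCounterpart hA hij,
      abs_apply_eq_of_cartanCounterpart hA hij.symm, or_comm]
  let s (l : ℕ) : Prop := ∃ i j : Fin n, (i : ℕ) = l ∧ (j : ℕ) = l + 1 ∧ B i j = -1
  have hlt (i j : Fin n) (hij : i < j) :
      adjMatrix (snake s n) (Sum.inl i) (Sum.inl j) = B i j := by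
    have habs := abs_apply_eq_of_cartanCounterpart hA hij.ne
    rcases (Nat.succ_le_of_lt hij).eq_or_lt with hsucc | hsucc
    · have hs : s i ↔ B i j = -1 := by
        refine ⟨?_, fun h => ⟨i, j, rfl, hsucc.symm, h⟩⟩
        rintro ⟨i', j', hi, hj, h⟩
        rwa [← Fin.ext hi, ← Fin.ext (hj.trans hsucc)]
      rw [adjMatrix_snake_succ s hsucc]
      rw [if_pos (.inl hsucc)] at habs
      split_ifs <;> grind
    · rw [adjMatrix_snake_of_succ_lt s hsucc]
      rw [if_neg (by omega), abs_eq_zero] at habs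
      exact habs.symm
  refine ⟨snake s n, isTriangulation_snake s, ?_⟩
  ext i j
  rcases lt_trichotomy i j with h | rfl | h
  · exact hlt i j h
  · rw [hB.apply_self, Matrix.submatrix_apply, adjMatrix_self]
  · rw [hswap j i h.ne, Matrix.submatrix_apply, adjMatrix_swap, hlt j i h]

theorem IsTypeA.isPolygonMatrix {B : Matrix (Fin n) (Fin n) ℤ} (hA : IsTypeA B)
    (hB : IsSkewSymmetrizable B) : IsPolygonMatrix B := by
  obtain ⟨w, σ, hσ⟩ := hA
  have hseed : IsPolygonMatrix ((seedAt B w).B.submatrix σ σ) :=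
    isPolygonMatrix_of_cartanCounterpart ((isSkewSymmetrizable_seedAt hB w).submatrix σ) <| by
      rw [← hσ]
      ext i j
      simp only [cartanCounterpart, Matrix.of_apply, Matrix.submatrix_apply, σ.injective.eq_iff]
  have hunpermute := hseed.submatrix σ.symm
  rw [Matrix.submatrix_submatrix, Equiv.self_comp_symm, Matrix.submatrix_id_id] at hunpermute
  exact isPolygonMatrix_of_seedAt hunpermute

/-- `Trop.toCoeff` as a monoid homomorphism. -/
def Trop.toCoeffHom : Trop n →* CoeffField n where
  toFun := Trop.toCoeff
  map_one' := Finset.prod_eq_one fun _ _ => zpow_zero _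
  map_mul' a b := by
    rw [Trop.toCoeff, Trop.toCoeff, Trop.toCoeff, ← Finset.prod_mul_distrib]
    refine Finset.prod_congr rfl fun i _ => zpow_add₀ ?_ _ _
    rw [Ne, IsFractionRing.to_map_eq_zero_iff]
    exact MvPolynomial.X_ne_zero i

theorem Trop.toCoeff_mul (a b : Trop n) : (a * b).toCoeff = a.toCoeff * b.toCoeff :=
  map_mul toCoeffHom a b

theorem Trop.toCoeff_div (a b : Trop n) : (a / b).toCoeff = a.toCoeff / b.toCoeff :=
  map_div toCoeffHom a b

theorem Trop.toCoeff_ne_zero (a : Trop n) : a.toCoeff ≠ 0 :=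
  ((Group.isUnit a).map toCoeffHom).ne_zero

theorem Trop.oplus_comm (a b : Trop n) : a.oplus b = b.oplus a :=
  congrArg Multiplicative.ofAdd (funext fun _ => min_comm _ _)

theorem Trop.oplus_div_right (a b c : Trop n) : (a / c).oplus (b / c) = a.oplus b / c :=
  congrArg Multiplicative.ofAdd (funext fun _ => min_sub_sub_right _ _ _)

theorem Trop.oplus_one_div (a b : Trop n) : Trop.oplus 1 (a / b) = a.oplus b / b := by
  rw [← div_self' b, oplus_div_right, oplus_comm]

theorem Trop.oplus_div_left_nonneg (a b : Trop n) (i : Fin n) :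
    0 ≤ Multiplicative.toAdd (a / a.oplus b) i :=
  sub_nonneg.2 (min_le_left _ _)

@[elab_as_elim]
theorem CyclicallyOrdered.rotate_induction {P : ℕ → ℕ → ℕ → ℕ → Prop}
    (lt : ∀ a b c d, a < b → b < c → c < d → P a b c d)
    (rotate : ∀ a b c d, P a b c d → P b c d a) {a b c d : ℕ} (h : CyclicallyOrdered a b c d) :
    P a b c d := by
  obtain h | h | h | h : a < b ∧ b < c ∧ c < d ∨ b < c ∧ c < d ∧ d < a ∨ c < d ∧ d < a ∧ a < b ∨
      d < a ∧ a < b ∧ b < c := by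
    simp only [CyclicallyOrdered, sbtw_iff] at h
    omega
  · exact lt _ _ _ _ h.1 h.2.1 h.2.2
  · exact rotate _ _ _ _ (rotate _ _ _ _ (rotate _ _ _ _ (lt _ _ _ _ h.1 h.2.1 h.2.2)))
  · exact rotate _ _ _ _ (rotate _ _ _ _ (lt _ _ _ _ h.1 h.2.1 h.2.2))
  · exact rotate _ _ _ _ (lt _ _ _ _ h.1 h.2.1 h.2.2)

/-- Up to gauge, half the number of crossings of the chord `x` with the elementary lamination of
the chord `f`. -/
def laminationExp (f x : ℕ × ℕ) : ℤ := if f.1 < x.1 ∧ x.2 ≤ f.2 then 1 else 0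

theorem laminationExp_ptolemy (f : ℕ × ℕ) {a b c d : ℕ} (h : CyclicallyOrdered a b c d) :
    laminationExp f (chord a c) + laminationExp f (chord b d) =
      min (laminationExp f (chord b c) + laminationExp f (chord d a))
        (laminationExp f (chord a b) + laminationExp f (chord c d)) := by
  refine CyclicallyOrdered.rotate_induction (fun a b c d hab hbc hcd => ?_)
    (fun a b c d ih => ?_) h
  · simp only [laminationExp, chord]
    split_ifs <;> omega
  · rw [add_comm, chord_comm c a, ih, min_comm, add_comm (laminationExp f (chord a b))]

/-- The Laurent monomial that normalizes the lambda length of the chord `x` relative to the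
triangulation `e`. -/
def laminationMonomial (e : EdgeLabel n → ℕ × ℕ) (x : ℕ × ℕ) : Trop n :=
  Multiplicative.ofAdd fun i => laminationExp (e (Sum.inl i)) x

theorem laminationMonomial_ptolemy (e : EdgeLabel n → ℕ × ℕ) {a b c d : ℕ}
    (h : CyclicallyOrdered a b c d) :
    laminationMonomial e (chord a c) * laminationMonomial e (chord b d) =
      Trop.oplus (laminationMonomial e (chord b c) * laminationMonomial e (chord d a))
        (laminationMonomial e (chord a b) * laminationMonomial e (chord c d)) :=
  congrArg Multiplicative.ofAdd (funext fun _ => laminationExp_ptolemy _ h)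

theorem exists_glue {ι α : Type*} [LinearOrder ι] {V W : ι → α} {r : ι} (h : V r = W r) :
    ∃ U : ι → α, (∀ i ≤ r, U i = V i) ∧ ∀ i, r ≤ i → U i = W i := by
  refine ⟨fun i => if i ≤ r then V i else W i, fun i hi => if_pos hi, fun i hi => ?_⟩
  rcases hi.eq_or_lt with rfl | hi
  · exact (if_pos le_rfl).trans h
  · exact if_neg hi.not_ge

section PlaneVectors

variable {K : Type*} [Field K]

/-- The determinant of two plane vectors. -/
def planeDet (v w : K × K) : K := v.1 * w.2 - v.2 * w.1

/-- The determinant of the vectors attached to the endpoints of a chord; for suitable vectors this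
is the lambda length of the chord. -/
def chordDet (V : ℕ → K × K) (x : ℕ × ℕ) : K := planeDet (V x.1) (V x.2)

theorem chordDet_ptolemy (V : ℕ → K × K) {a b c d : ℕ} (h : CyclicallyOrdered a b c d) :
    chordDet V (chord a c) * chordDet V (chord b d) =
      chordDet V (chord b c) * chordDet V (chord d a) +
        chordDet V (chord a b) * chordDet V (chord c d) := by
  refine CyclicallyOrdered.rotate_induction (fun a b c d hab hbc hcd => ?_)
    (fun a b c d ih => ?_) h
  · rw [chord_comm d a]
    simp only [chordDet, planeDet, chord, min_eq_left, max_eq_right, hab.le, hbc.le, hcd.le,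
      (hab.trans hbc).le, (hbc.trans hcd).le, ((hab.trans hbc).trans hcd).le]
    ring
  · rw [mul_comm, chord_comm c a, ih, add_comm, mul_comm (chordDet V (chord a b))]

theorem exists_planeDet_eq {v w : K × K} (h : planeDet v w ≠ 0) (α β : K) :
    ∃ u, planeDet v u = α ∧ planeDet u w = β := by
  refine ⟨(planeDet v w)⁻¹ • (β • v + α • w), ?_, ?_⟩ <;>
  · simp only [planeDet, Prod.smul_fst, Prod.smul_snd, Prod.fst_add, Prod.snd_add, smul_eq_mul]
      at *
    field_simp
    ring

theorem IsTriangulation.eq_or_le_of_apex {e : EdgeLabel n → ℕ × ℕ} (h : IsTriangulation e)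
    {p r q : ℕ} (hpr : p < r) (hrq : r < q) (hpr_mem : chord p r ∈ Set.range e)
    (hrq_mem : chord r q ∈ Set.range e) {x : ℕ × ℕ} (hx : x ∈ Set.range e) (hp : p ≤ x.1)
    (hq : x.2 ≤ q) : x = (p, q) ∨ x.2 ≤ r ∨ r ≤ x.1 := by
  obtain ⟨j, rfl⟩ := hx
  obtain ⟨i, hi⟩ := hpr_mem
  obtain ⟨k, hk⟩ := hrq_mem
  have hlt := h.lt j
  have hpr' := hi ▸ h.not_crosses j i
  have hrq' := hk ▸ h.not_crosses j k
  generalize e j = x at *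
  obtain ⟨s, t⟩ := x
  simp only [chord, Crosses, Prod.mk.injEq] at *
  omega

theorem IsTriangulation.exists_vectors_under {e : EdgeLabel n → ℕ × ℕ} (h : IsTriangulation e)
    {g : ℕ × ℕ → K} (hg : ∀ x, g x ≠ 0) {p q : ℕ} (hlt : p < q) (hpq : chord p q ∈ Set.range e)
    {v w : K × K} (hvw : planeDet v w = g (p, q)) :
    ∃ V : ℕ → K × K, V p = v ∧ V q = w ∧
      ∀ x ∈ Set.range e, p ≤ x.1 → x.2 ≤ q → chordDet V x = g x := by
  induction hl : q - p using Nat.strong_induction_on generalizing p q v w with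
  | _ l ih =>
  subst hl
  rcases (Nat.succ_le_of_lt hlt).eq_or_lt with rfl | hsucc
  · refine ⟨fun i => if i = p then v else w, if_pos rfl, if_neg (by omega), ?_⟩
    rintro _ ⟨j, rfl⟩ hp hq
    have hj : e j = (p, p + 1) := by
      have := h.lt j
      exact Prod.ext (by simp only; omega) (by simp only; omega)
    simpa only [hj, chordDet, if_true, Nat.succ_ne_self, if_false] using hvw
  · obtain ⟨r, hr, hpr_mem, hrq_mem⟩ := h.exists_apex hpq
      (v := p + 1) (by have := h.le_of_chord_mem hpq; omega) (by simp only [sbtw_iff]; omega)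
    obtain ⟨hpr, hrq⟩ : p < r ∧ r < q := by
      simp only [sbtw_iff] at hr
      omega
    obtain ⟨u, hvu, huw⟩ := exists_planeDet_eq (hvw ▸ hg (p, q)) (g (p, r)) (g (r, q))
    obtain ⟨V, hVp, hVr, hV⟩ := ih _ (by omega) hpr hpr_mem hvu rfl
    obtain ⟨W, hWr, hWq, hW⟩ := ih _ (by omega) hrq hrq_mem huw rfl
    obtain ⟨U, hUV, hUW⟩ := exists_glue (hVr.trans hWr.symm)
    refine ⟨U, (hUV p hpr.le).trans hVp, (hUW q hrq.le).trans hWq, fun x hx hp hq => ?_⟩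
    have hx_lt : x.1 < x.2 := by
      obtain ⟨j, rfl⟩ := hx
      exact h.lt j
    rcases h.eq_or_le_of_apex hpr hrq hpr_mem hrq_mem hx hp hq with rfl | hxr | hrx
    · rw [chordDet, hUV p hpr.le, hUW q hrq.le, hVp, hWq, hvw]
    · rw [chordDet, hUV _ (hx_lt.le.trans hxr), hUV _ hxr]
      exact hV x hx hp hxr
    · rw [chordDet, hUW _ hrx, hUW _ (hrx.trans hx_lt.le)]
      exact hW x hx hrx hq

theorem IsTriangulation.exists_vectors {e : EdgeLabel n → ℕ × ℕ} (h : IsTriangulation e)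
    {g : ℕ × ℕ → K} (hg : ∀ x, g x ≠ 0) :
    ∃ V : ℕ → K × K, ∀ x ∈ Set.range e, chordDet V x = g x := by
  have hside : chord 0 (n + 2) ∈ Set.range e := by
    have hmem := h.side_mem_range (v := n + 2) le_rfl
    rwa [nextVertex, if_pos rfl, chord_comm] at hmem
  obtain ⟨V, -, -, hV⟩ := h.exists_vectors_under hg (Nat.succ_pos _) hside
    (v := (1, 0)) (w := (0, g (0, n + 2))) (by simp only [planeDet, one_mul, zero_mul, sub_zero])
  refine ⟨V, fun x hx => hV x hx (Nat.zero_le _) ?_⟩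
  obtain ⟨j, rfl⟩ := hx
  exact h.le j

end PlaneVectors

/-- `F` is a system of lambda lengths of the chords of the polygon, normalized by the lamination
monomials so that it is `1` on the triangulation `e`. -/
structure IsNormalizedLength (e : EdgeLabel n → ℕ × ℕ) (F : ℕ × ℕ → CoeffField n) : Prop where
  eq_one : ∀ x ∈ Set.range e, F x = 1
  exchange : ∀ {a b c d}, CyclicallyOrdered a b c d → F (chord a c) * F (chord b d) =
    Trop.toCoeff (laminationMonomial e (chord b c) * laminationMonomial e (chord d a) /
      (laminationMonomial e (chord a c) * laminationMonomial e (chord b d))) *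
        (F (chord b c) * F (chord d a)) +
    Trop.toCoeff (laminationMonomial e (chord a b) * laminationMonomial e (chord c d) /
      (laminationMonomial e (chord a c) * laminationMonomial e (chord b d))) *
        (F (chord a b) * F (chord c d))

theorem IsTriangulation.exists_isNormalizedLength {e : EdgeLabel n → ℕ × ℕ}
    (h : IsTriangulation e) : ∃ F, IsNormalizedLength e F := by
  have hne (x : ℕ × ℕ) := Trop.toCoeff_ne_zero (laminationMonomial e x)
  obtain ⟨V, hV⟩ := h.exists_vectors hne
  refine ⟨fun x => chordDet V x / (laminationMonomial e x).toCoeff, fun x hx => ?_, fun hord => ?_⟩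
  · rw [hV x hx, div_self (hne x)]
  · simp only [Trop.toCoeff_mul, Trop.toCoeff_div]
    rw [div_mul_div_comm, chordDet_ptolemy V hord]
    field_simp [hne]

/-- `z` is a nonzero polynomial in `y_1, …, y_n` with coefficients in `ℕ` and degree at most `d i`
in each `y_i`. -/
def IsPositivePolynomial (d : Fin n → ℕ) (z : CoeffField n) : Prop :=
  ∃ P : MvPolynomial (Fin n) ℕ, P ≠ 0 ∧ (∀ i, P.degreeOf i ≤ d i) ∧
    z = algebraMap _ _ (P.map (Nat.castRingHom ℤ))

namespace IsPositivePolynomial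

variable {d d' : Fin n → ℕ} {z z' : CoeffField n}

theorem mono (h : IsPositivePolynomial d z) (hd : d ≤ d') : IsPositivePolynomial d' z :=
  let ⟨P, hP, hdeg, hz⟩ := h
  ⟨P, hP, fun i => (hdeg i).trans (hd i), hz⟩

theorem one : IsPositivePolynomial d 1 :=
  ⟨1, one_ne_zero, fun i => by simp, by simp⟩

theorem add (h : IsPositivePolynomial d z) (h' : IsPositivePolynomial d z') :
    IsPositivePolynomial d (z + z') := by
  obtain ⟨P, hP, hdeg, rfl⟩ := h
  obtain ⟨Q, -, hdeg', rfl⟩ := h'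
  refine ⟨P + Q, fun h0 => hP (MvPolynomial.ext _ _ fun m => ?_), fun i =>
    (MvPolynomial.degreeOf_add_le i P Q).trans (max_le (hdeg i) (hdeg' i)), by simp⟩
  have hm := congrArg (MvPolynomial.coeff m) h0
  rw [MvPolynomial.coeff_add] at hm
  exact (Nat.add_eq_zero_iff.1 hm).1

theorem mul (h : IsPositivePolynomial d z) (h' : IsPositivePolynomial d' z') :
    IsPositivePolynomial (d + d') (z * z') := by
  obtain ⟨P, hP, hdeg, rfl⟩ := h
  obtain ⟨Q, hQ, hdeg', rfl⟩ := h'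
  exact ⟨P * Q, mul_ne_zero hP hQ, fun i =>
    (MvPolynomial.degreeOf_mul_le i P Q).trans (add_le_add (hdeg i) (hdeg' i)), by simp⟩

theorem toCoeff {m : Trop n} (hm : ∀ i, 0 ≤ Multiplicative.toAdd m i) :
    IsPositivePolynomial (fun i => (Multiplicative.toAdd m i).toNat) m.toCoeff := by
  refine ⟨MvPolynomial.monomial
    (Finsupp.equivFunOnFinite.symm fun i => (Multiplicative.toAdd m i).toNat) 1,
    MvPolynomial.monomial_eq_zero.not.2 one_ne_zero, fun i => ?_, ?_⟩
  · rw [MvPolynomial.degreeOf_monomial_eq _ _ one_ne_zero,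
      Finsupp.equivFunOnFinite_symm_apply_apply]
  · rw [MvPolynomial.map_monomial, map_one, MvPolynomial.monomial_eq, map_one, one_mul,
      Finsupp.prod_fintype _ _ fun _ => pow_zero _, map_prod]
    refine Finset.prod_congr rfl fun i _ => ?_
    rw [Finsupp.equivFunOnFinite_symm_apply_apply, map_pow, ← zpow_natCast,
      Int.toNat_of_nonneg (hm i)]

end IsPositivePolynomial

/-- The `i`-th entry records whether the chord `x` crosses the `i`-th diagonal of the
triangulation `e`. -/
def crossingVector (e : EdgeLabel n → ℕ × ℕ) (x : ℕ × ℕ) (i : Fin n) : ℕ :=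
  open Classical in if Crosses (e (Sum.inl i)) x then 1 else 0

section CrossedDiagonals

variable {u b v d : ℕ} {f : ℕ × ℕ}

theorem Crosses.of_crosses_side (h : Crosses (chord u v) (chord b d))
    (hbd : ¬ Crosses f (chord b d)) (hbv : Crosses f (chord b v)) : Crosses f (chord u v) := by
  simp only [chord, Crosses] at h hbd hbv ⊢
  omega

theorem laminationExp_add_eq_of_crosses_side (h : Crosses (chord u v) (chord b d))
    (hbd : ¬ Crosses f (chord b d)) (hbv : Crosses f (chord b v)) :
    laminationExp f (chord b v) + laminationExp f (chord d u) =
      laminationExp f (chord u v) + laminationExp f (chord b d) := by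
  simp only [chord, Crosses] at h hbd hbv
  simp only [laminationExp, chord]
  split_ifs <;> omega

theorem laminationExp_add_eq_of_not_crosses (h : Crosses (chord u v) (chord b d))
    (hbd : ¬ Crosses f (chord b d)) (huv : ¬ Crosses f (chord u v)) :
    laminationExp f (chord b v) + laminationExp f (chord d u) =
      laminationExp f (chord u v) + laminationExp f (chord b d) := by
  simp only [chord, Crosses] at h hbd huv
  simp only [laminationExp, chord]
  split_ifs <;> omega

theorem laminationExp_add_le :
    laminationExp f (chord b v) + laminationExp f (chord d u) ≤
      laminationExp f (chord u v) + laminationExp f (chord b d) + 1 := by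
  simp only [laminationExp, chord]
  split_ifs <;> omega

end CrossedDiagonals

theorem IsTriangulation.crossingVector_lt {e : EdgeLabel n → ℕ × ℕ} (h : IsTriangulation e)
    {u b v d : ℕ} (hv : v ≤ n + 2) (hu : u ≤ n + 2) (hcross : Crosses (chord u v) (chord b d))
    (hbd : chord b d ∈ Set.range e) :
    crossingVector e (chord b v) < crossingVector e (chord u v) := by
  obtain ⟨j | s, hj⟩ := hbd
  · refine Pi.lt_def.2 ⟨fun i => ?_, j, ?_⟩
    · simp only [crossingVector]
      have := Crosses.of_crosses_side hcross (hj ▸ h.not_crosses (Sum.inl i) (Sum.inl j))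
      split_ifs <;> simp_all
    · have hbv : ¬ Crosses (chord b d) (chord b v) := by
        simp only [Crosses, chord]
        omega
      simp only [crossingVector, hj, hbv, crosses_comm.1 hcross, if_true, if_false, zero_lt_one]
  · rw [h.side] at hj
    rw [← hj] at hcross
    exact absurd hcross (not_crosses_side (Nat.lt_succ_iff.1 s.2) (max_le hu hv))

theorem IsTriangulation.isPositivePolynomial_exchange_term {e : EdgeLabel n → ℕ × ℕ}
    (h : IsTriangulation e) {u b v d : ℕ} (hcross : Crosses (chord u v) (chord b d))
    (hbd : chord b d ∈ Set.range e) {m : Trop n}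
    (hm : m = laminationMonomial e (chord b v) * laminationMonomial e (chord d u) /
      (laminationMonomial e (chord u v) * laminationMonomial e (chord b d)))
    (hnonneg : ∀ i, 0 ≤ Multiplicative.toAdd m i) {z : CoeffField n}
    (hz : IsPositivePolynomial (crossingVector e (chord b v)) z) :
    IsPositivePolynomial (crossingVector e (chord u v)) (m.toCoeff * z) := by
  refine ((IsPositivePolynomial.toCoeff hnonneg).mul hz).mono fun i => ?_
  obtain ⟨j, hj⟩ := hbd
  have hbd : ¬ Crosses (e (Sum.inl i)) (chord b d) := hj ▸ h.not_crosses _ _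
  have hexp : Multiplicative.toAdd m i =
      laminationExp (e (Sum.inl i)) (chord b v) + laminationExp (e (Sum.inl i)) (chord d u) -
        (laminationExp (e (Sum.inl i)) (chord u v) +
          laminationExp (e (Sum.inl i)) (chord b d)) := by
    rw [hm]
    rfl
  have hle := laminationExp_add_le (u := u) (b := b) (v := v) (d := d) (f := e (Sum.inl i))
  have hbv := laminationExp_add_eq_of_crosses_side hcross hbd
  have huv := laminationExp_add_eq_of_not_crosses hcross hbd
  have hsub := Crosses.of_crosses_side hcross hbd
  simp only [Pi.add_apply, crossingVector, hexp]
  split_ifs <;> grind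

theorem IsNormalizedLength.isPositivePolynomial {e : EdgeLabel n → ℕ × ℕ} (h : IsTriangulation e)
    {F : ℕ × ℕ → CoeffField n} (hF : IsNormalizedLength e F) {u v : ℕ} (hu : u ≤ n + 2)
    (hv : v ≤ n + 2) (huv : u ≠ v) :
    IsPositivePolynomial (crossingVector e (chord u v)) (F (chord u v)) := by
  induction hN : crossingVector e (chord u v) using WellFoundedLT.induction generalizing u v with
  | _ N ih =>
  subst hN
  by_cases hmem : chord u v ∈ Set.range e
  · rw [hF.eq_one _ hmem]
    exact IsPositivePolynomial.one
  obtain ⟨b, d, hord, hub, hbd, hdu⟩ := h.exists_crossed_triangle hu hv huv hmem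
  have hcross := hord.crosses
  have hcross' : Crosses (chord u v) (chord d b) := chord_comm b d ▸ hcross
  have hdb : chord d b ∈ Set.range e := chord_comm b d ▸ hbd
  have hbv : b ≠ v ∧ d ≠ v := by
    simp only [CyclicallyOrdered, sbtw_iff] at hord
    omega
  have hexch := hF.exchange hord
  rw [hF.eq_one _ hub, hF.eq_one _ hbd, hF.eq_one _ hdu, mul_one, mul_one, one_mul] at hexch
  rw [hexch]
  refine IsPositivePolynomial.add ?_ ?_
  · refine h.isPositivePolynomial_exchange_term hcross hbd rfl (fun i => ?_)
      (ih _ (h.crossingVector_lt hv hu hcross hbd) (h.le_of_chord_mem hub) hv hbv.1 rfl)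
    rw [laminationMonomial_ptolemy e hord]
    exact Trop.oplus_div_left_nonneg _ _ i
  · rw [chord_comm v d]
    refine h.isPositivePolynomial_exchange_term hcross' hdb ?_ (fun i => ?_)
      (ih _ (h.crossingVector_lt hv hu hcross' hdb) (h.le_of_chord_mem hbd) hv hbv.2 rfl)
    · rw [chord_comm b d, chord_comm u b, mul_comm (laminationMonomial e (chord b u))]
    rw [laminationMonomial_ptolemy e hord, Trop.oplus_comm, chord_comm d v]
    exact Trop.oplus_div_left_nonneg _ _ i

namespace HasValueAtOne

variable {z z' : AmbientField n} {v v' : CoeffField n}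

theorem algebraMap_ne_zero {D : MvPolynomial (Fin n) (CoeffField n)}
    (h : MvPolynomial.eval (fun _ => 1) D ≠ 0) : algebraMap _ (AmbientField n) D ≠ 0 := by
  rw [Ne, IsFractionRing.to_map_eq_zero_iff]
  rintro rfl
  exact h (map_zero _)

theorem algebraMap (N : MvPolynomial (Fin n) (CoeffField n)) :
    HasValueAtOne (algebraMap _ (AmbientField n) N) (MvPolynomial.eval (fun _ => 1) N) :=
  ⟨N, 1, by simp, by simp, by simp⟩

theorem toAmbient (a : Trop n) : HasValueAtOne a.toAmbient a.toCoeff := by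
  have hC := algebraMap (MvPolynomial.C a.toCoeff)
  rwa [MvPolynomial.eval_C] at hC

theorem one : HasValueAtOne (1 : AmbientField n) 1 := by
  simpa only [map_one] using algebraMap (1 : MvPolynomial (Fin n) (CoeffField n))

theorem add (h : HasValueAtOne z v) (h' : HasValueAtOne z' v') :
    HasValueAtOne (z + z') (v + v') := by
  obtain ⟨N, D, hD, rfl, rfl⟩ := h
  obtain ⟨N', D', hD', rfl, rfl⟩ := h'
  refine ⟨N * D' + D * N', D * D', by simpa only [map_mul] using mul_ne_zero hD hD', ?_, ?_⟩
  · rw [div_add_div _ _ (algebraMap_ne_zero hD) (algebraMap_ne_zero hD')]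
    simp only [map_add, map_mul]
  · rw [div_add_div _ _ hD hD']
    simp only [map_add, map_mul]

theorem mul (h : HasValueAtOne z v) (h' : HasValueAtOne z' v') :
    HasValueAtOne (z * z') (v * v') := by
  obtain ⟨N, D, hD, rfl, rfl⟩ := h
  obtain ⟨N', D', hD', rfl, rfl⟩ := h'
  refine ⟨N * N', D * D', by simpa only [map_mul] using mul_ne_zero hD hD', ?_, ?_⟩ <;>
    simp only [div_mul_div_comm, map_mul]

theorem inv (h : HasValueAtOne z v) (hv : v ≠ 0) : HasValueAtOne z⁻¹ v⁻¹ := by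
  obtain ⟨N, D, -, rfl, rfl⟩ := h
  exact ⟨D, N, fun hN => hv (by rw [hN, zero_div]), inv_div _ _, inv_div _ _⟩

theorem prod {ι : Type*} (s : Finset ι) {f : ι → AmbientField n} {g : ι → CoeffField n}
    (h : ∀ i, HasValueAtOne (f i) (g i)) : HasValueAtOne (∏ i ∈ s, f i) (∏ i ∈ s, g i) :=
  Finset.prod_hom_rel one fun i _ _ => (h i).mul

theorem zpow (h : HasValueAtOne z v) {m : ℤ} (hm : 0 ≤ m) : HasValueAtOne (z ^ m) (v ^ m) := by
  lift m to ℕ using hm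
  simpa only [zpow_natCast, Finset.prod_const, Finset.card_range] using
    prod (Finset.range m) fun _ => h

theorem unique (h : HasValueAtOne z v) (h' : HasValueAtOne z v') : v = v' := by
  obtain ⟨N, D, hD, rfl, rfl⟩ := h
  obtain ⟨N', D', hD', hz, rfl⟩ := h'
  rw [div_eq_div_iff (algebraMap_ne_zero hD) (algebraMap_ne_zero hD'), ← map_mul, ← map_mul] at hz
  rw [div_eq_div_iff hD hD', ← map_mul, ← map_mul,
    IsFractionRing.injective _ (AmbientField n) hz]

end HasValueAtOne

section ExchangeMonomials

variable {J G : Type*} [Fintype J] {e : J → ℕ × ℕ} {k : J} {a b c d : ℕ}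

theorem prod_zpow_oppositeSides [DivisionCommMonoid G] (he : Function.Injective e)
    (g : ℕ × ℕ → G) (hab : chord a b ∈ Set.range e) (hcd : chord c d ∈ Set.range e)
    (hne : chord a b ≠ chord c d) :
    ∏ j, g (e j) ^ oppositeSides a b c d (e j) = g (chord a b) * g (chord c d) := by
  obtain ⟨i, hi⟩ := hab
  obtain ⟨l, hl⟩ := hcd
  have hil : i ≠ l := by
    rintro rfl
    exact hne (hi.symm.trans hl)
  rw [Fintype.prod_eq_mul i l hil]
  · rw [oppositeSides, ← hi, ← hl]
    simp [he.ne hil, he.ne hil.symm]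
  · rintro j ⟨hji, hjl⟩
    rw [oppositeSides, ← hi, ← hl]
    simp [he.ne hji, he.ne hjl]

namespace IsFlippable

theorem prod_zpow_max_adjMatrix [DivisionCommMonoid G] (hf : IsFlippable e k a b c d)
    (he : Function.Injective e) (g : ℕ × ℕ → G) :
    ∏ j, g (e j) ^ max (adjMatrix e j k) 0 = g (chord b c) * g (chord d a) := by
  simp only [hf.max_adjMatrix]
  exact prod_zpow_oppositeSides he g (Set.image_subset_range _ _ hf.quad.bc_mem)
    (Set.image_subset_range _ _ hf.quad.da_mem) hf.quad.rotate.ab_ne_cd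

theorem prod_zpow_max_neg_adjMatrix [DivisionCommMonoid G] (hf : IsFlippable e k a b c d)
    (he : Function.Injective e) (g : ℕ × ℕ → G) :
    ∏ j, g (e j) ^ max (-adjMatrix e j k) 0 = g (chord a b) * g (chord c d) := by
  simp only [hf.max_neg_adjMatrix]
  exact prod_zpow_oppositeSides he g (Set.image_subset_range _ _ hf.quad.ab_mem)
    (Set.image_subset_range _ _ hf.quad.cd_mem) hf.quad.ab_ne_cd

theorem columnMonomial_adjMatrix [CommGroup G] (hf : IsFlippable e k a b c d)
    (he : Function.Injective e) (g : ℕ × ℕ → G) :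
    columnMonomial (g ∘ e) (adjMatrix e) k =
      g (chord b c) * g (chord d a) / (g (chord a b) * g (chord c d)) := by
  simp only [columnMonomial_eq_div, Function.comp_apply, hf.prod_zpow_max_adjMatrix he,
    hf.prod_zpow_max_neg_adjMatrix he]

end IsFlippable

end ExchangeMonomials

theorem laminationExp_sides {a b c d : ℕ} {f : ℕ × ℕ} (h : CyclicallyOrdered a b c d)
    (hab : ¬ Crosses f (chord a b)) (hbc : ¬ Crosses f (chord b c))
    (hcd : ¬ Crosses f (chord c d)) (hda : ¬ Crosses f (chord d a))
    (hac : ¬ Crosses f (chord a c)) :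
    laminationExp f (chord b c) + laminationExp f (chord d a) -
      (laminationExp f (chord a b) + laminationExp f (chord c d)) =
        if f = chord a c then 1 else 0 := by
  split_ifs with hf
  · subst hf
    simp only [CyclicallyOrdered, sbtw_iff] at h
    simp only [laminationExp, chord]
    split_ifs <;> omega
  · have hbd : ¬ Crosses f (chord b d) := fun hbd =>
      hf (by rw [chord_comm]; exact h.rotate.eq_chord_of_crosses hbd hbc hcd hda hab)
    have hcross : Crosses (chord a c) (chord d b) := chord_comm b d ▸ h.crosses
    rw [laminationExp_add_eq_of_not_crosses h.crosses hbd hac, sub_eq_zero, chord_comm b d,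
      ← laminationExp_add_eq_of_not_crosses hcross (chord_comm b d ▸ hbd) hac, chord_comm d c,
      chord_comm b a, add_comm]

/-- The seed `s` of the cluster pattern with initial triangulation `e₀` is the one attached to the
triangulation `e`; `F` is the system of normalized lambda lengths of `e₀`. -/
structure IsSeedOf (e₀ e : EdgeLabel n → ℕ × ℕ) (F : ℕ × ℕ → CoeffField n) (s : Seed n) :
    Prop where
  isTriangulation : IsTriangulation e
  matrix : (adjMatrix e).submatrix Sum.inl Sum.inl = s.B
  coeff : ∀ k, s.y k = columnMonomial (laminationMonomial e₀ ∘ e) (adjMatrix e) (Sum.inl k)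
  value : ∀ i, HasValueAtOne (s.x i) (F (e (Sum.inl i)))

theorem IsTriangulation.gen_eq_columnMonomial {e : EdgeLabel n → ℕ × ℕ} (h : IsTriangulation e)
    (k : Fin n) :
    Trop.gen k = columnMonomial (laminationMonomial e ∘ e) (adjMatrix e) (Sum.inl k) := by
  obtain ⟨a, b, c, d, hf⟩ := h.exists_isFlippable k
  rw [hf.columnMonomial_adjMatrix h.injective]
  refine congrArg Multiplicative.ofAdd (funext fun i => ?_)
  have hside {x : ℕ × ℕ} (hx : x ∈ e '' {Sum.inl k}ᶜ) : ¬ Crosses (e (Sum.inl i)) x := by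
    obtain ⟨j, -, rfl⟩ := hx
    exact h.not_crosses _ _
  have hdiagonal : i = k ↔ e (Sum.inl i) = chord a c := by
    rw [← hf.diagonal, h.injective.eq_iff, Sum.inl.injEq]
  rw [Pi.single_apply, if_congr hdiagonal rfl rfl]
  exact (laminationExp_sides hf.quad.ordered (hside hf.quad.ab_mem) (hside hf.quad.bc_mem)
    (hside hf.quad.cd_mem) (hside hf.quad.da_mem) (hf.diagonal ▸ h.not_crosses _ _)).symm

theorem IsNormalizedLength.isSeedOf_initialSeed {e : EdgeLabel n → ℕ × ℕ}
    (h : IsTriangulation e) {F : ℕ × ℕ → CoeffField n} (hF : IsNormalizedLength e F) :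
    IsSeedOf e e F (initialSeed ((adjMatrix e).submatrix Sum.inl Sum.inl)) where
  isTriangulation := h
  matrix := rfl
  coeff := h.gen_eq_columnMonomial
  value i := by
    rw [hF.eq_one _ (Set.mem_range_self _)]
    have hX := HasValueAtOne.algebraMap (MvPolynomial.X (R := CoeffField n) i)
    rwa [MvPolynomial.eval_X] at hX

theorem IsNormalizedLength.prod_inl {e₀ e : EdgeLabel n → ℕ × ℕ} (h₀ : IsTriangulation e₀)
    (h : IsTriangulation e) {F : ℕ × ℕ → CoeffField n} (hF : IsNormalizedLength e₀ F)
    (m : EdgeLabel n → ℤ) :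
    ∏ i : Fin n, F (e (Sum.inl i)) ^ m (Sum.inl i) = ∏ j, F (e j) ^ m j := by
  have hside (v : Fin (n + 3)) : F (e (Sum.inr v)) = 1 := by
    rw [h.side, ← h₀.side]
    exact hF.eq_one _ (Set.mem_range_self _)
  simp only [Fintype.prod_sum_type, hside, one_zpow, Finset.prod_const_one, mul_one]

theorem IsPositivePolynomial.ne_zero {d : Fin n → ℕ} {z : CoeffField n}
    (h : IsPositivePolynomial d z) : z ≠ 0 := by
  obtain ⟨P, hP, -, rfl⟩ := h
  rw [Ne, IsFractionRing.to_map_eq_zero_iff,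
    map_eq_zero_iff _ (MvPolynomial.map_injective (Nat.castRingHom ℤ) Nat.cast_injective)]
  exact hP

namespace IsSeedOf

variable {e₀ e : EdgeLabel n → ℕ × ℕ} {F : ℕ × ℕ → CoeffField n} {s : Seed n} {k : Fin n}
  {a b c d : ℕ}

theorem oplus_one_coeff (hs : IsSeedOf e₀ e F s) (hf : IsFlippable e (Sum.inl k) a b c d) :
    Trop.oplus 1 (s.y k) =
      laminationMonomial e₀ (chord a c) * laminationMonomial e₀ (chord b d) /
        (laminationMonomial e₀ (chord a b) * laminationMonomial e₀ (chord c d)) := by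
  rw [hs.coeff, hf.columnMonomial_adjMatrix hs.isTriangulation.injective, Trop.oplus_one_div,
    laminationMonomial_ptolemy e₀ hf.quad.ordered]

theorem mutate_coeff (hs : IsSeedOf e₀ e F s) (hf : IsFlippable e (Sum.inl k) a b c d)
    (j : Fin n) :
    (s.mutate k).y j = columnMonomial (Function.update (laminationMonomial e₀ ∘ e) (Sum.inl k)
      (laminationMonomial e₀ (chord b d))) (matrixMutation (Sum.inl k) (adjMatrix e))
        (Sum.inl j) := by
  rcases eq_or_ne j k with rfl | hj
  · rw [columnMonomial_update_matrixMutation_self _ _ (adjMatrix_self e _), ← hs.coeff]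
    exact if_pos rfl
  · have htropical : (laminationMonomial e₀ ∘ e) (Sum.inl k) * laminationMonomial e₀ (chord b d) =
        (∏ i, (laminationMonomial e₀ ∘ e) i ^ max (-adjMatrix e i (Sum.inl k)) 0) *
          Trop.oplus 1 (s.y k) := by
      simp only [Function.comp_apply]
      rw [hf.prod_zpow_max_neg_adjMatrix hs.isTriangulation.injective, hs.oplus_one_coeff hf,
        hf.diagonal, mul_div_cancel]
    rw [columnMonomial_update_matrixMutation_of_ne (adjMatrix_self e _) htropical
      (Sum.inl_injective.ne hj), ← hs.coeff, ← hs.coeff]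
    simp only [Seed.mutate, if_neg hj, ← hs.matrix, Matrix.submatrix_apply]

theorem prod_zpow_value (h₀ : IsTriangulation e₀) (hF : IsNormalizedLength e₀ F)
    (hs : IsSeedOf e₀ e F s) {m : EdgeLabel n → ℤ} (hm : ∀ j, 0 ≤ m j) :
    HasValueAtOne (∏ i, s.x i ^ m (Sum.inl i)) (∏ j, F (e j) ^ m j) :=
  hF.prod_inl h₀ hs.isTriangulation m ▸
    HasValueAtOne.prod _ fun i => (hs.value i).zpow (hm (Sum.inl i))

theorem mutate_value (h₀ : IsTriangulation e₀) (hF : IsNormalizedLength e₀ F)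
    (hs : IsSeedOf e₀ e F s) (hf : IsFlippable e (Sum.inl k) a b c d)
    (hne : F (chord a c) ≠ 0) : HasValueAtOne ((s.mutate k).x k) (F (chord b d)) := by
  have hpos := hs.prod_zpow_value h₀ hF fun j => le_max_right (adjMatrix e j (Sum.inl k)) 0
  have hneg := hs.prod_zpow_value h₀ hF fun j => le_max_right (-adjMatrix e j (Sum.inl k)) 0
  rw [hf.prod_zpow_max_adjMatrix hs.isTriangulation.injective] at hpos
  rw [hf.prod_zpow_max_neg_adjMatrix hs.isTriangulation.injective] at hneg
  have hcoeff : s.y k / Trop.oplus 1 (s.y k) =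
      laminationMonomial e₀ (chord b c) * laminationMonomial e₀ (chord d a) /
        (laminationMonomial e₀ (chord a c) * laminationMonomial e₀ (chord b d)) := by
    rw [hs.oplus_one_coeff hf, hs.coeff,
      hf.columnMonomial_adjMatrix hs.isTriangulation.injective, div_div_div_cancel_right]
  have hcoeff' : 1 / Trop.oplus 1 (s.y k) =
      laminationMonomial e₀ (chord a b) * laminationMonomial e₀ (chord c d) /
        (laminationMonomial e₀ (chord a c) * laminationMonomial e₀ (chord b d)) := by
    rw [hs.oplus_one_coeff hf, one_div_div]
  have hvalue := ((hf.diagonal ▸ hs.value k).inv hne).mul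
    (((HasValueAtOne.toAmbient (s.y k / Trop.oplus 1 (s.y k))).mul hpos).add
      ((HasValueAtOne.toAmbient (1 / Trop.oplus 1 (s.y k))).mul hneg))
  have hexchange := hF.exchange hf.quad.ordered
  rw [← hcoeff, ← hcoeff'] at hexchange
  rw [← hexchange, inv_mul_cancel_left₀ hne] at hvalue
  simpa only [Seed.mutate, if_true, ← hs.matrix, Matrix.submatrix_apply] using hvalue

theorem mutate (h₀ : IsTriangulation e₀) (hF : IsNormalizedLength e₀ F)
    (hs : IsSeedOf e₀ e F s) (hf : IsFlippable e (Sum.inl k) a b c d)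
    (hne : F (chord a c) ≠ 0) :
    IsSeedOf e₀ (Function.update e (Sum.inl k) (chord b d)) F (s.mutate k) where
  isTriangulation := hs.isTriangulation.flip hf
  matrix := hf.submatrix_adjMatrix_update.trans (congrArg _ hs.matrix)
  coeff j := by
    rw [hs.mutate_coeff hf, hf.adjMatrix_update, Function.comp_update]
  value i := by
    rcases eq_or_ne i k with rfl | hi
    · rw [Function.update_self]
      exact hs.mutate_value h₀ hF hf hne
    · rw [Function.update_of_ne (Sum.inl_injective.ne hi)]
      simpa only [Seed.mutate, if_neg hi] using hs.value i

end IsSeedOf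

theorem IsNormalizedLength.isPositivePolynomial_diagonal {e₀ e : EdgeLabel n → ℕ × ℕ}
    (h₀ : IsTriangulation e₀) {F : ℕ × ℕ → CoeffField n} (hF : IsNormalizedLength e₀ F)
    (h : IsTriangulation e) (j : EdgeLabel n) :
    IsPositivePolynomial (crossingVector e₀ (e j)) (F (e j)) := by
  have hj := h.lt j
  rw [← chord_of_lt hj]
  exact hF.isPositivePolynomial h₀ (hj.le.trans (h.le j)) (h.le j) hj.ne

theorem IsNormalizedLength.exists_isSeedOf_seedAt {e₀ : EdgeLabel n → ℕ × ℕ}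
    (h₀ : IsTriangulation e₀) {F : ℕ × ℕ → CoeffField n} (hF : IsNormalizedLength e₀ F)
    (w : List (Fin n)) :
    ∃ e, IsSeedOf e₀ e F (seedAt ((adjMatrix e₀).submatrix Sum.inl Sum.inl) w) := by
  induction w using List.reverseRecOn with
  | nil => exact ⟨e₀, hF.isSeedOf_initialSeed h₀⟩
  | append_singleton w k ih =>
    obtain ⟨e, hs⟩ := ih
    obtain ⟨a, b, c, d, hf⟩ := hs.isTriangulation.exists_isFlippable k
    rw [seedAt_concat]
    have hne := (hF.isPositivePolynomial_diagonal h₀ hs.isTriangulation (Sum.inl k)).ne_zero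
    exact ⟨_, hs.mutate h₀ hF hf (hf.diagonal ▸ hne)⟩

theorem IsPolygonMatrix.exists_isFPolynomial {B : Matrix (Fin n) (Fin n) ℤ}
    (hB : IsPolygonMatrix B) (w : List (Fin n)) (i : Fin n) :
    ∃ P : MvPolynomial (Fin n) ℕ, P ≠ 0 ∧ (∀ j, P.degreeOf j ≤ 1) ∧
      IsFPolynomial B w i (P.map (Nat.castRingHom ℤ)) := by
  obtain ⟨e₀, h₀, rfl⟩ := hB
  obtain ⟨F, hF⟩ := h₀.exists_isNormalizedLength
  obtain ⟨e, hs⟩ := hF.exists_isSeedOf_seedAt h₀ w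
  obtain ⟨P, hP, hdeg, hFP⟩ := hF.isPositivePolynomial_diagonal h₀ hs.isTriangulation (Sum.inl i)
  refine ⟨P, hP, fun j => (hdeg j).trans ?_, ?_⟩
  · unfold crossingVector
    split_ifs <;> simp
  · rw [IsFPolynomial, ← hFP]
    exact hs.value i

theorem IsFPolynomial.unique {B : Matrix (Fin n) (Fin n) ℤ} {w : List (Fin n)} {i : Fin n}
    {P Q : MvPolynomial (Fin n) ℤ} (hP : IsFPolynomial B w i P) (hQ : IsFPolynomial B w i Q) :
    P = Q :=
  IsFractionRing.injective _ (CoeffField n) (HasValueAtOne.unique hP hQ)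

theorem isLogConcave_of_degreeOf_le_one {m : ℕ} {f : MvPolynomial (Fin m) ℝ} (hf : f ≠ 0)
    (hcoeff : ∀ a, 0 ≤ f.coeff a) (hdeg : ∀ j, f.degreeOf j ≤ 1) : IsLogConcave f := by
  refine ⟨hf, hcoeff, fun j a => ?_⟩
  suffices h : intCoeff f (a - Pi.single j 1) * intCoeff f (a + Pi.single j 1) = 0 by
    rw [h]
    exact sq_nonneg _
  rcases lt_or_ge (a j) 1 with ha | ha
  · apply mul_eq_zero_of_left
    rw [intCoeff, if_neg]
    intro h
    have := h j
    simp only [Pi.sub_apply, Pi.single_eq_same] at this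
    omega
  · apply mul_eq_zero_of_right
    rw [intCoeff, ite_eq_right_iff]
    refine fun _ => MvPolynomial.notMem_support_iff.1 fun hmem => ?_
    have := (MvPolynomial.monomial_le_degreeOf j hmem).trans (hdeg j)
    simp only [Finsupp.coe_equivFunOnFinite_symm, Pi.add_apply, Pi.single_eq_same] at this
    omega

theorem degreeOf_map_le {σ R S : Type*} [CommSemiring R] [CommSemiring S] (f : R →+* S)
    (P : MvPolynomial σ R) (i : σ) : (P.map f).degreeOf i ≤ P.degreeOf i := by
  classical
  simp only [MvPolynomial.degreeOf_def]
  exact Multiset.count_le_of_le i MvPolynomial.degrees_map_le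

end Cluster

end

theorem theorem6p6 (n : ℕ) (B : Matrix (Fin n) (Fin n) ℤ)
    (hB : Cluster.IsSkewSymmetrizable B) (hA : Cluster.IsTypeA B)
    (w : List (Fin n)) (i : Fin n) :
    (∃! F : MvPolynomial (Fin n) ℤ, Cluster.IsFPolynomial B w i F) ∧
    ∀ F : MvPolynomial (Fin n) ℤ, Cluster.IsFPolynomial B w i F →
      Cluster.IsLogConcave (MvPolynomial.map (Int.castRingHom ℝ) F) ∧
      ∀ j : Fin n, F.degreeOf j ≤ 1 := by
  obtain ⟨P, hP, hdeg, hF⟩ := (hA.isPolygonMatrix hB).exists_isFPolynomial w i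
  refine ⟨⟨_, hF, fun Q hQ => hQ.unique hF⟩, fun Q hQ => ?_⟩
  obtain rfl := hQ.unique hF
  have hreal : (P.map (Nat.castRingHom ℤ)).map (Int.castRingHom ℝ) = P.map (Nat.castRingHom ℝ) := by
    rw [MvPolynomial.map_map, RingHom.eq_natCast' ((Int.castRingHom ℝ).comp _)]
  rw [hreal]
  refine ⟨Cluster.isLogConcave_of_degreeOf_le_one ?_ (fun a => ?_) fun j => ?_, fun j => ?_⟩
  · rwa [Ne, map_eq_zero_iff _
      (MvPolynomial.map_injective (Nat.castRingHom ℝ) Nat.cast_injective)]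
  · rw [MvPolynomial.coeff_map]
    exact Nat.cast_nonneg _
  · exact (Cluster.degreeOf_map_le _ P j).trans (hdeg j)
  · exact (Cluster.degreeOf_map_le _ P j).trans (hdeg j)
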